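/- **Setting.** An involution $\alpha$ of size $n$ is a permutation of $\{1,\dots,n\}$ with $\alpha^2=\mathrm{id}$. It is drawn as an arc diagram on the dots $1,\dots,n$, with an arc $(i,\alpha(i))$ for every $i<\alpha(i)$, the fixed points being isolated dots. Changing every fixed point into an open arc (an arc with a left endpoint but no right endpoint) identifies involutions of size $n$ with open matchings of length $n$. The opener/closer sequence of $\alpha$ records for each $i$ whether $i\le\alpha(i)$ (opener; fixed points are openers) or $i>\alpha(i)$ (closer). **Nesting levels.** $\mathrm{enhne}(\alpha)$ is the maximal number of dots in an enhanced nesting of $\alpha$, i.e. in a family of arcs $(i_1,j_1),\dots,(i_k,j_k)$ with $i_1<\dots<i_k\le j_k<\dots<j_1$, where a fixed point $i$ counts as the trivial arc $(i,i)$, with one dot. $\mathrm{futne}(\alpha)$ is the maximal number of dots in a nesting of the associated open matching, i.e. in a family consisting of arcs $(i_1,j_1),\dots,(i_k,j_k)$ with $i_1<\dots<i_k<j_k<\dots<j_1$ and possibly one open arc (with one dot) whose left endpoint is to the left of all of these. Let $A_{i,j}$ be the set of involutions $\alpha$ (of any size) with $\mathrm{enhne}(\alpha)=i$ and $\mathrm{futne}(\alpha)=j$.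 **The map $\theta$.** Tableaux here have strictly decreasing rows and columns, and insertion is Robinson–Schensted–Knuth row insertion for the decreasing order. To a diagram of disjoint arcs and isolated dots on $\{1,\dots,N\}$ one associates tableaux $T_0=\varnothing,T_1,\dots,T_{2N}$: for $i=1,\dots,N$, $T_{2i-1}$ is $T_{2i-2}$ with the entry $i$ deleted if $i$ is a right endpoint, and $T_{2i-1}=T_{2i-2}$ otherwise; then $T_{2i}$ is $T_{2i-1}$ with $j$ inserted if $i$ is the left endpoint of an arc $(i,j)$, and $T_{2i}=T_{2i-1}$ otherwise. Let $\tau$ be the transposition of every shape in a sequence of shapes. * For an involution $\alpha$ of size $n$, let $\phi(\alpha)$ be the sequence of shapes of $T_0,\dots,T_{2n}$, and let $\psi(\alpha)$ be the involution of size $n$ with $\phi(\psi(\alpha))=\tau(\phi(\alpha))$. * For an open matching $\beta$ of length $n$, with open arcs at $i_1<\dots<i_m$, let $R(\beta)$ (resp. $C(\beta)$) be the sequence of shapes of $T_0,T_2,\dots,T_{2n}$ for the matching on $\{1,\dots,n+m\}$ obtained by replacing the open arcs with the arcs $(i_r,n+m+1-r)$ (resp. $(i_r,n+r)$), $1\le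 r\le m$. Let $\chi(\beta)$ be the open matching of length $n$ with $C(\chi(\beta))=\tau(R(\beta))$. Then $\theta=\chi\circ\psi$, where $\psi(\alpha)$ is read as an open matching and the open arcs of the final result are read as fixed points. **Proposition.** The involutions $\psi(\alpha)$ and $\chi(\beta)$ exist and are unique, so that $\theta$ is well defined, and $\theta$ is a bijection from the set of all involutions to itself. For every $k\ge 0$ and $\alpha\in A_{2k,2k+1}$ there is $m\ge1$ with $\theta^{m}(\alpha)\in A_{2k+1,2k}$; let $m_\alpha$ be the smallest such $m$. For every $k\ge0$ and $\alpha\in A_{2k+1,2k}$ there is $m\ge1$ with $\theta^{-m}(\alpha)\in A_{2k,2k+1}$; let $m_\alpha$ be the opposite of the smallest such $m$. For every other involution $\alpha$ put $m_\alpha=0$. Then the map $\alpha\mapsto\theta^{m_\alpha}(\alpha)$ is an involution on the set of all involutions that exchanges the statistics $\mathrm{enhne}$ and $\mathrm{futne}$. It preserves the size, the number of fixed points, and the opener/closer sequence. -/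

import Mathlib

namespace InvolutionNesting

/-! ### Young tableaux with decreasing rows and columns, and RSK insertion -/

/-- A filling of a Ferrers diagram, given as the list of its rows, from top to bottom. In the
tableaux below, rows and columns are strictly decreasing. -/
abbrev Tableau := List (List ℕ)

/-- Insertion of `x` in one row, for the decreasing order: the leftmost entry smaller than `x`
is replaced by `x` and bumped; if there is none, `x` is put at the end of the row. Returns the
new row and the bumped entry, if any. -/
def rowInsert (x : ℕ) : List ℕ → List ℕ × Option ℕ
  | [] => ([x], none)
  | y :: ys =>
    if y < x then (x :: ys, some y)
    else (y :: (rowInsert x ys).1, (rowInsert x ys).2)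

/-- Robinson-Schensted-Knuth insertion for the decreasing order: a bumped entry is
inserted in the next row. -/
def rskInsert : Tableau → ℕ → Tableau
  | [], x => [[x]]
  | R :: Rs, x =>
    match rowInsert x R with
    | (R', none) => R' :: Rs
    | (R', some y) => R' :: rskInsert Rs y

/-- Deletion of the entry `x` (a row that becomes empty disappears). -/
def tabDelete (T : Tableau) (x : ℕ) : Tableau :=
  (T.map fun R => R.filter fun y => y ≠ x).filter fun R => R ≠ []

/-- The shape of a tableau, as the set of its cells `(row, column)`. -/
def shape (T : Tableau) : Finset (ℕ × ℕ) :=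
  (Finset.range T.length).biUnion fun r =>
    (Finset.range (T.getD r []).length).image fun c => (r, c)

/-- Transposition of every diagram in a sequence of diagrams. -/
def transposeSeq {N : ℕ} (s : Fin N → Finset (ℕ × ℕ)) : Fin N → Finset (ℕ × ℕ) :=
  fun t => (s t).image Prod.swap

/-- The tableau sequence of an arc diagram read from left to right. Dots are numbered from `0`,
and `p i` is the other endpoint of the arc at the dot `i`, with `p i = i` for an isolated dot.
The dot `i` accounts for two half-steps: if it is a right endpoint, `i` is deleted; then, if it
is a left endpoint, its partner `p i` is inserted. -/
def tableauSeq (p : ℕ → ℕ) : ℕ → Tableau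
  | 0 => []
  | t + 1 =>
    if t % 2 = 0 then
      if p (t / 2) < t / 2 then tabDelete (tableauSeq p t) (t / 2) else tableauSeq p t
    else
      if t / 2 < p (t / 2) then rskInsert (tableauSeq p t) (p (t / 2)) else tableauSeq p t

/-! ### Involutions, seen as arc diagrams or as open matchings -/

/-- Involutions of size `n`. As an arc diagram, its arcs are the pairs `(i, α i)` with `i < α i`,
and its fixed points are isolated dots. The same data is an open matching of length `n`, when
every fixed point is read as the left endpoint of an open arc. -/
abbrev Invol (n : ℕ) := {σ : Equiv.Perm (Fin n) // ∀ i, σ (σ i) = i}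

instance (n : ℕ) : Nonempty (Invol n) := ⟨⟨1, fun _ => rfl⟩⟩

/-- The partner of a dot in the arc diagram of an involution (fixed points are isolated). -/
def partner {n : ℕ} (α : Invol n) (i : ℕ) : ℕ :=
  if h : i < n then (α.1 ⟨i, h⟩ : ℕ) else i

/-- The number of fixed points, i.e. of open arcs of the associated open matching. -/
def numFixed {n : ℕ} (α : Invol n) : ℕ := (Finset.univ.filter fun i => α.1 i = i).card

/-- The number of fixed points to the left of the dot `i`. -/
def fixedBefore {n : ℕ} (α : Invol n) (i : ℕ) : ℕ :=
  (Finset.univ.filter fun j : Fin n => (j : ℕ) < i ∧ α.1 j = j).card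

/-- The map `φ`: the vacillating tableau (of length `2n`) of the arc diagram of `α`. -/
def vacillating {n : ℕ} (α : Invol n) : Fin (2 * n + 1) → Finset (ℕ × ℕ) :=
  fun t => shape (tableauSeq (partner α) t)

/-- Partners in the closed matching obtained from the open matching `α` by joining its open arcs
`i₁ < ⋯ < i_m` to new dots placed after the others, in decreasing order: `i₁` is joined to the
last new dot, and `i_m` to the first one, so that the new arcs are nested. Only the values at
dots `i < n` are relevant. -/
def partnerNested {n : ℕ} (α : Invol n) (i : ℕ) : ℕ :=
  if partner α i = i then n + numFixed α - 1 - fixedBefore α i else partner α i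

/-- The same, with open arcs closed in increasing order: `i₁` is joined to the first new dot,
and `i_m` to the last one, so that the new arcs cross. -/
def partnerCrossed {n : ℕ} (α : Invol n) (i : ℕ) : ℕ :=
  if partner α i = i then n + fixedBefore α i else partner α i

/-- The oscillating tableau of length `n`, ending in a row, of an open matching: the first
`n` full steps for the closed matching with nested new arcs. The height of the diagrams is
governed by the crossings of the open matching. -/
def oscRow {n : ℕ} (α : Invol n) : Fin (n + 1) → Finset (ℕ × ℕ) :=
  fun t => shape (tableauSeq (partnerNested α) (2 * t))

/-- The oscillating tableau of length `n`, ending in a column, of an open matching: the first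
`n` full steps for the closed matching with crossing new arcs. The width of the diagrams is
governed by the nestings of the open matching. -/
def oscColumn {n : ℕ} (α : Invol n) : Fin (n + 1) → Finset (ℕ × ℕ) :=
  fun t => shape (tableauSeq (partnerCrossed α) (2 * t))

/-- The map `ψ = φ⁻¹ ∘ τ ∘ φ`, from involution diagrams to open matchings (fixed points of the
result being read as open arcs). -/
noncomputable def psi {n : ℕ} (α : Invol n) : Invol n :=
  Function.invFun vacillating (transposeSeq (vacillating α))

/-- From open matchings to open matchings: take the oscillating tableau ending in a row,
transpose it, and go back by the correspondence with oscillating tableaux ending in a column. -/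
noncomputable def chi {n : ℕ} (β : Invol n) : Invol n :=
  Function.invFun oscColumn (transposeSeq (oscRow β))

/-- The class of all involutions, of all sizes. -/
abbrev Involution := Σ n : ℕ, Invol n

/-- The size of an involution. -/
def size (α : Involution) : ℕ := α.1

/-- The number of fixed points of an involution. -/
def fixedCount (α : Involution) : ℕ := numFixed α.2

/-- The opener/closer sequence: `true` for an opener (fixed points are openers), `false` for a
closer. -/
def openerCloser (α : Involution) : List Bool := List.ofFn fun i : Fin α.1 => decide (i ≤ α.2.1 i)

/-- The map `θ`. -/
noncomputable def theta (α : Involution) : Involution := ⟨α.1, chi (psi α.2)⟩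

/-! ### Nesting levels -/

/-- `S` is the set of left endpoints `i₁ < ⋯ < i_k` of an enhanced `k`-nesting
`i₁ < ⋯ < i_k ≤ j_k < ⋯ < j₁`, where `j_r = α i_r` and a fixed point `i` stands for the trivial
arc `(i, i)` (it can only be the innermost one). -/
def IsEnhancedNesting {n : ℕ} (α : Invol n) (S : Finset (Fin n)) : Prop :=
  (∀ i ∈ S, i ≤ α.1 i) ∧ ∀ i ∈ S, ∀ j ∈ S, i < j → α.1 j < α.1 i

/-- `S` is the set of left endpoints of a `k`-nesting of the open matching obtained from `α` by
changing fixed points into open arcs: mutually nesting arcs, and possibly one open arc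
whose left endpoint is to the left of all these arcs. -/
def IsOpenNesting {n : ℕ} (α : Invol n) (S : Finset (Fin n)) : Prop :=
  (∀ i ∈ S, i ≤ α.1 i) ∧ ∀ i ∈ S, ∀ j ∈ S, i < j → j < α.1 j ∧ (α.1 i = i ∨ α.1 j < α.1 i)

/-- The number of dots of the arcs with left endpoints in `S`. -/
def dots {n : ℕ} (α : Invol n) (S : Finset (Fin n)) : ℕ := (S ∪ S.image fun i => α.1 i).card

open Classical in
/-- The enhanced nesting level: the maximal number of dots in an enhanced nesting. -/
noncomputable def enhne (α : Involution) : ℕ :=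
  (Finset.univ.filter fun S => IsEnhancedNesting α.2 S).sup (dots α.2)

open Classical in
/-- The open nesting level: the maximal number of dots in a nesting of the open matching. -/
noncomputable def futne (α : Involution) : ℕ :=
  (Finset.univ.filter fun S => IsOpenNesting α.2 S).sup (dots α.2)

/-- The set `A_{i,j}`. -/
def A (i j : ℕ) : Set Involution := {α | enhne α = i ∧ futne α = j}

/-! ### The iteration -/

open Classical in
/-- The exponent `m_α`, for a bijection `Θ` of the class of involutions: for `α ∈ A_{2k,2k+1}`,
the smallest `m` such that `Θ^m α ∈ A_{2k+1,2k}`; for `α ∈ A_{2k+1,2k}`, the opposite of the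
smallest `m` such that `Θ^(-m) α ∈ A_{2k,2k+1}`; and `0` otherwise. -/
noncomputable def swapExponent (Θ : Equiv.Perm Involution) (α : Involution) : ℤ :=
  if ∃ k, α ∈ A (2 * k) (2 * k + 1) then
    (sInf {m : ℕ | ∃ k, α ∈ A (2 * k) (2 * k + 1) ∧
      (Θ ^ (m : ℤ)) α ∈ A (2 * k + 1) (2 * k)} : ℕ)
  else if ∃ k, α ∈ A (2 * k + 1) (2 * k) then
    -((sInf {m : ℕ | ∃ k, α ∈ A (2 * k + 1) (2 * k) ∧
      (Θ ^ (-(m : ℤ))) α ∈ A (2 * k) (2 * k + 1)} : ℕ) : ℤ)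
  else 0

/-- The map `α ↦ Θ^(m_α) α`. -/
noncomputable def swapMap (Θ : Equiv.Perm Involution) (α : Involution) : Involution :=
  (Θ ^ swapExponent Θ α) α

end InvolutionNesting

/-! At every gap `t`, the tableau reached is Knuth equivalent to the word of the right endpoints of
the arcs over that gap, listed by left endpoint (`IsPartialMatching.represents`): an opener appends
a letter, a closer erases the smallest one, and both operations respect Knuth equivalence. The
lengths of the longest decreasing and increasing subsequences are Knuth invariants, and in the
reading word of a tableau they are the numbers of columns and rows. So the width of a shape is the
largest nesting over the gap and its height the largest crossing (`zero_mem_shape_tab`,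
`mem_shape_tab_zero`), and transposition exchanges the two.

Each step can be undone, so a walk on diagrams together with a last tableau comes from exactly one
partial matching (`exists_partialMatching`, `partialMatching_unique`). The last tableau is no extra
datum: it is empty for `vacillating`, and for `oscRow` and `oscColumn` it is the row or column
filled with the new dots. Hence `psi` and `chi` are well defined and injective, so `theta` permutes
the finite set of involutions of each size. Sizes of shapes survive transposition, which preserves
closers and the number of fixed points.

An enhanced nesting is a nesting over a gap, possibly with a fixed point inside it. After `psi` it
is a crossing, possibly with a fixed point under all its arcs; in the nested closure the new arc of
this fixed point crosses all of them, and no crossing uses two new arcs. After `chi` it is a nesting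
of the crossed closure, in which only the outermost arc can be new, that is, an open nesting. This
gives `openNest_theta`: `openNest (theta α) = enhNest α`.

With `nest` the number of arcs in a largest nesting, both `enhNest` and `openNest` equal `nest` or
`nest + 1`, and `enhne` and `futne` are obtained from them by adding `nest`. So `openNest` performs,
along an orbit of `theta`, a cyclic walk with steps in {-1, 0, 1}, the step leaving `α` going from
`openNest α` to `enhNest α`. The set `A (2k) (2k+1)` consists of the steps from k+1 down to k, and
`A (2k+1) (2k)` of the steps from k up to k+1. On a cycle these alternate, so matching each step
down with the next step up is a bijection whose inverse looks for the last step down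
(`exists_isLeast_step_up`). This is the involution. -/

namespace InvolutionNesting

/-! ### Tableaux and row insertion -/

/-- The row `S` fits under the row `R`: it is not longer, and columns are decreasing. -/
def Below : List ℕ → List ℕ → Prop
  | _, [] => True
  | [], _ :: _ => False
  | x :: xs, y :: ys => y < x ∧ Below xs ys

/-- Fillings with nonempty rows, and strictly decreasing rows and columns. -/
def IsTableau : Tableau → Prop
  | [] => True
  | R :: Rs => R ≠ [] ∧ R.Pairwise (· > ·) ∧ Below R (Rs.headD []) ∧ IsTableau Rs

@[simp] theorem below_nil (R : List ℕ) : Below R [] := by cases R <;> simp [Below]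

@[simp] theorem below_cons (x y : ℕ) (xs ys : List ℕ) :
    Below (x :: xs) (y :: ys) ↔ y < x ∧ Below xs ys := Iff.rfl

@[simp] theorem not_nil_below (y : ℕ) (ys : List ℕ) : ¬ Below [] (y :: ys) := id

theorem Below.length_le : ∀ {R S : List ℕ}, Below R S → S.length ≤ R.length
  | _, [], _ => by simp
  | [], _ :: _, h => absurd h (not_nil_below _ _)
  | _ :: _, _ :: _, h => by simpa using h.2.length_le

theorem Below.exists_lt : ∀ {R S : List ℕ}, Below R S → ∀ y ∈ S, ∃ x ∈ R, y < x
  | _, [], _ => by simp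
  | [], _ :: _, h => absurd h (not_nil_below _ _)
  | x :: _, _ :: _, h => by
    intro z hz
    rcases List.mem_cons.1 hz with rfl | hz
    · exact ⟨x, by simp, h.1⟩
    · obtain ⟨w, hw, hlt⟩ := h.2.exists_lt z hz
      exact ⟨w, by simp [hw], hlt⟩

theorem rowInsert_cons (x a : ℕ) (R : List ℕ) :
    rowInsert x (a :: R) = if a < x then (x :: R, some a)
      else (a :: (rowInsert x R).1, (rowInsert x R).2) := rfl

theorem rowInsert_perm (x : ℕ) (R : List ℕ) :
    ((rowInsert x R).1 ++ (rowInsert x R).2.toList).Perm (x :: R) := by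
  induction R with
  | nil => simp [rowInsert]
  | cons a R ih =>
    rw [rowInsert_cons]
    split_ifs with h
    · simp only [Option.toList_some, List.cons_append]
      exact List.Perm.cons _ (by simp)
    · simpa using (List.Perm.cons a ih).trans (List.Perm.swap x a R)

theorem rowInsert_none {x : ℕ} {R : List ℕ} (h : (rowInsert x R).2 = none) :
    (rowInsert x R).1 = R ++ [x] ∧ ∀ a ∈ R, x ≤ a := by
  induction R with
  | nil => simp [rowInsert]
  | cons a R ih =>
    rw [rowInsert_cons] at h ⊢
    split_ifs at h ⊢ with hax
    obtain ⟨h1, h2⟩ := ih h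
    refine ⟨by simp [h1], ?_⟩
    simp only [List.mem_cons, forall_eq_or_imp]
    exact ⟨by omega, h2⟩

theorem rowInsert_append {x : ℕ} {R : List ℕ} (h : ∀ a ∈ R, x ≤ a) :
    rowInsert x R = (R ++ [x], none) := by
  induction R with
  | nil => simp [rowInsert]
  | cons a R ih =>
    have ha := h a (by simp)
    rw [rowInsert_cons, if_neg (by omega), ih fun b hb => h b (by simp [hb])]
    simp

theorem rowInsert_some_length {x y : ℕ} {R : List ℕ} (h : (rowInsert x R).2 = some y) :
    (rowInsert x R).1.length = R.length := by
  have := (rowInsert_perm x R).length_eq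
  simpa [h] using this

theorem rowInsert_some_mem {x y : ℕ} {R : List ℕ} (h : (rowInsert x R).2 = some y) :
    y ∈ R ∧ y < x := by
  induction R with
  | nil => simp [rowInsert] at h
  | cons a R ih =>
    rw [rowInsert_cons] at h
    split_ifs at h with hax
    · simp only [Option.some.injEq] at h; subst h; simp [hax]
    · obtain ⟨h1, h2⟩ := ih h
      exact ⟨by simp [h1], h2⟩

theorem mem_rowInsert {x z : ℕ} {R : List ℕ} (h : z ∈ (rowInsert x R).1) : z = x ∨ z ∈ R := by
  have := (rowInsert_perm x R).subset (List.mem_append_left _ h)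
  simpa using this

theorem mem_rowInsert_self (x : ℕ) (R : List ℕ) : x ∈ (rowInsert x R).1 := by
  induction R with
  | nil => simp [rowInsert]
  | cons a R ih => rw [rowInsert_cons]; split_ifs <;> simp [ih]

theorem pairwise_rowInsert {x : ℕ} {R : List ℕ} (hR : R.Pairwise (· > ·)) (hx : x ∉ R) :
    (rowInsert x R).1.Pairwise (· > ·) := by
  induction R with
  | nil => simp [rowInsert]
  | cons a R ih =>
    simp only [List.mem_cons, not_or] at hx
    rw [List.pairwise_cons] at hR
    rw [rowInsert_cons]
    split_ifs with h
    · exact List.pairwise_cons.2 ⟨fun b hb => (hR.1 b hb).trans h, hR.2⟩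
    · refine List.pairwise_cons.2 ⟨fun b hb => ?_, ih hR.2 hx.2⟩
      rcases mem_rowInsert hb with rfl | hb
      · omega
      · exact hR.1 b hb

/-- Bumping only replaces an entry of the upper row by a larger one. -/
theorem Below.rowInsert_left {x y : ℕ} : ∀ {R S : List ℕ}, Below R S →
    (rowInsert x R).2 = some y → Below (rowInsert x R).1 S
  | _, [], _, _ => by simp
  | [], _ :: _, h, _ => absurd h (not_nil_below _ _)
  | a :: R, b :: S, h, hy => by
    rw [rowInsert_cons] at hy ⊢
    split_ifs at hy ⊢ with hax
    · exact ⟨h.1.trans hax, h.2⟩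
    · exact ⟨h.1, h.2.rowInsert_left hy⟩

/-- Bumping keeps columns decreasing. -/
theorem Below.rowInsert {x y : ℕ} : ∀ {R S : List ℕ}, R.Pairwise (· > ·) → Below R S →
    (rowInsert x R).2 = some y →
    Below (InvolutionNesting.rowInsert x R).1 (InvolutionNesting.rowInsert y S).1
  | [], _, _, _, hy => by simp [InvolutionNesting.rowInsert] at hy
  | a :: R, [], hR, h, hy => by
    rw [rowInsert_cons] at hy ⊢
    split_ifs at hy ⊢ with hax
    · simp only [Option.some.injEq] at hy; subst hy
      simp [InvolutionNesting.rowInsert, hax]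
    · have := List.rel_of_pairwise_cons hR (rowInsert_some_mem hy).1
      simpa [InvolutionNesting.rowInsert] using this
  | a :: R, b :: S, hR, h, hy => by
    rw [rowInsert_cons] at hy ⊢
    rw [rowInsert_cons]
    split_ifs at hy ⊢ with hax hby hby
    · simp only [Option.some.injEq] at hy; subst hy
      exact ⟨hax, h.2⟩
    · simp only [Option.some.injEq] at hy; subst hy
      exact absurd h.1 hby
    · exact ⟨List.rel_of_pairwise_cons hR (rowInsert_some_mem hy).1, h.2.rowInsert_left hy⟩
    · exact ⟨h.1, Below.rowInsert (List.Pairwise.of_cons hR) h.2 hy⟩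

/-- Reverse bumping lowers one entry of the upper row to `y`, which does no harm when `y` exceeds
everything in `S`. -/
theorem below_of_rowInsert_left {x y : ℕ} : ∀ {R S : List ℕ},
    (InvolutionNesting.rowInsert x R).2 = some y → (∀ b ∈ S, b < y) →
    Below (InvolutionNesting.rowInsert x R).1 S → Below R S
  | _, [], _, _, _ => by simp
  | [], _ :: _, hy, _, _ => by simp [InvolutionNesting.rowInsert] at hy
  | a :: R, b :: S, hy, hS, h => by
    rw [rowInsert_cons] at hy h
    split_ifs at hy h with hax
    · simp only [Option.some.injEq] at hy; subst hy
      exact ⟨hS b (by simp), h.2⟩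
    · exact ⟨h.1, below_of_rowInsert_left hy (fun c hc => hS c (by simp [hc])) h.2⟩

/-- Reverse bumping keeps columns decreasing. -/
theorem below_of_rowInsert {x y : ℕ} : ∀ {R S : List ℕ}, R.Pairwise (· > ·) →
    S.Pairwise (· > ·) → y ∉ S → (InvolutionNesting.rowInsert x R).2 = some y →
    Below (InvolutionNesting.rowInsert x R).1 (InvolutionNesting.rowInsert y S).1 → Below R S
  | _, [], _, _, _, _, _ => by simp
  | [], _ :: _, _, _, _, hy, _ => by simp [InvolutionNesting.rowInsert] at hy
  | a :: R, b :: S, hR, hS, hyS, hy, h => by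
    simp only [List.mem_cons, not_or] at hyS
    rw [List.pairwise_cons] at hR hS
    rw [rowInsert_cons] at hy h
    rw [rowInsert_cons] at h
    split_ifs at hy h with hax hby hby
    · simp only [Option.some.injEq] at hy; subst hy
      exact ⟨hby, h.2⟩
    · simp only [Option.some.injEq] at hy; subst hy
      obtain ⟨z, hz, hlt⟩ := h.2.exists_lt a (mem_rowInsert_self _ _)
      have := hR.1 z hz
      omega
    · refine ⟨hby.trans (hR.1 _ (rowInsert_some_mem hy).1), below_of_rowInsert_left hy ?_ h.2⟩
      exact fun c hc => (hS.1 c hc).trans hby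
    · exact ⟨h.1, below_of_rowInsert hR.2 hS.2 hyS.2 hy h.2⟩

/-- Reverse row insertion exists. -/
theorem exists_rowInsert_eq {y : ℕ} : ∀ {R : List ℕ}, R.Pairwise (· > ·) → y ∉ R →
    (∃ a ∈ R, y < a) → ∃ R' x, R'.Pairwise (· > ·) ∧ rowInsert x R' = (R, some y)
  | [], _, _, h => by simp at h
  | a :: R, hR, hy, h => by
    simp only [List.mem_cons, not_or] at hy
    rw [List.pairwise_cons] at hR
    -- The entry to expel is the rightmost one larger than `y`; `y` takes its place.
    by_cases hex : ∃ b ∈ R, y < b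
    · obtain ⟨R', x, h1, h2⟩ := exists_rowInsert_eq hR.2 hy.2 hex
      have hxR : x ∈ R := by simpa [h2] using mem_rowInsert_self x R'
      have hxa := hR.1 x hxR
      refine ⟨a :: R', x, List.pairwise_cons.2 ⟨fun b hb => ?_, h1⟩, ?_⟩
      · have hp := rowInsert_perm x R'
        rw [h2] at hp
        have : b ∈ R ++ [y] := hp.symm.subset (by simp [hb])
        rw [List.mem_append, List.mem_singleton] at this
        rcases this with hbR | rfl
        · exact hR.1 b hbR
        · obtain ⟨c, hc, hlt⟩ := hex
          exact hlt.trans (hR.1 c hc)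
      · rw [rowInsert_cons, if_neg (by omega), h2]
    · push Not at hex
      have hya : y < a := by
        obtain ⟨b, hb, hlt⟩ := h
        rcases List.mem_cons.1 hb with rfl | hb
        · exact hlt
        · exact absurd (hex b hb) (by omega)
      refine ⟨y :: R, a, List.pairwise_cons.2 ⟨fun b hb => ?_, hR.2⟩, ?_⟩
      · exact lt_of_le_of_ne (hex b hb) (fun h => hy.2 (h ▸ hb))
      · rw [rowInsert_cons, if_pos hya]

/-- Reverse row insertion is unique. -/
theorem rowInsert_inj_some {x₁ x₂ y : ℕ} : ∀ {R₁ R₂ : List ℕ}, R₁.Pairwise (· > ·) →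
    R₂.Pairwise (· > ·) → (rowInsert x₁ R₁).2 = some y → (rowInsert x₂ R₂).2 = some y →
    (rowInsert x₁ R₁).1 = (rowInsert x₂ R₂).1 → x₁ = x₂ ∧ R₁ = R₂
  | [], _, _, _, h, _, _ => by simp [InvolutionNesting.rowInsert] at h
  | _, [], _, _, _, h, _ => by simp [InvolutionNesting.rowInsert] at h
  | a :: R₁, b :: R₂, hR₁, hR₂, h₁, h₂, h => by
    rw [List.pairwise_cons] at hR₁ hR₂
    rw [rowInsert_cons] at h₁ h
    rw [rowInsert_cons] at h₂ h
    split_ifs at h₁ h₂ h with hax hbx hbx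
    · simp_all
    -- If the bumps occurred in different columns, `x₂` would stand to the right of the bumped entry
    -- `a` in a decreasing row, yet it is larger than `a`, which it bumped too. The next case is
    -- symmetric.
    · simp only [Option.some.injEq] at h₁; subst h₁
      simp only [List.cons.injEq] at h
      have h3 := mem_rowInsert_self x₂ R₂
      rw [← h.2] at h3
      have := hR₁.1 _ h3
      have := (rowInsert_some_mem h₂).2
      omega
    · simp only [Option.some.injEq] at h₂; subst h₂
      simp only [List.cons.injEq] at h
      have h3 := mem_rowInsert_self x₁ R₁
      rw [h.2] at h3
      have := hR₂.1 _ h3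
      have := (rowInsert_some_mem h₁).2
      omega
    · simp only [List.cons.injEq] at h
      obtain ⟨rfl, rfl⟩ := rowInsert_inj_some hR₁.2 hR₂.2 h₁ h₂ h.2
      exact ⟨rfl, by rw [h.1]⟩

/-! ### Shapes -/

theorem mem_shape {T : Tableau} {r c : ℕ} : (r, c) ∈ shape T ↔ c < (T.getD r []).length := by
  simp only [shape, Finset.mem_biUnion, Finset.mem_range, Finset.mem_image, Prod.mk.injEq]
  constructor
  · rintro ⟨r', _, c', h, rfl, rfl⟩
    exact h
  · intro h
    refine ⟨r, ?_, c, h, rfl, rfl⟩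
    by_contra hr
    rw [List.getD_eq_default _ _ (by omega)] at h
    simp at h

@[simp] theorem shape_nil : shape [] = ∅ := rfl

@[simp] theorem mem_shape_cons_zero {R : List ℕ} {Rs : Tableau} {c : ℕ} :
    (0, c) ∈ shape (R :: Rs) ↔ c < R.length := by simp [mem_shape]

@[simp] theorem mem_shape_cons_succ {R : List ℕ} {Rs : Tableau} {r c : ℕ} :
    (r + 1, c) ∈ shape (R :: Rs) ↔ (r, c) ∈ shape Rs := by simp [mem_shape]

theorem shape_cons_inj {R R' : List ℕ} {Rs Rs' : Tableau} (h : shape (R :: Rs) = shape (R' :: Rs')) :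
    R.length = R'.length ∧ shape Rs = shape Rs' := by
  constructor
  · have h0 : ∀ c, c < R.length ↔ c < R'.length := fun c => by
      rw [← mem_shape_cons_zero (Rs := Rs), h, mem_shape_cons_zero]
    have := h0 R.length
    have := h0 R'.length
    omega
  · ext ⟨r, c⟩
    rw [← mem_shape_cons_succ (R := R), h, mem_shape_cons_succ]

theorem shape_cons_ne_nil {R : List ℕ} {Rs : Tableau} (hR : R ≠ []) : shape (R :: Rs) ≠ ∅ :=
  Finset.ne_empty_of_mem (mem_shape_cons_zero.2 (List.length_pos_iff.2 hR))

/-- As no row is empty, the shape also determines the number of rows. -/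
theorem IsTableau.map_length_eq : ∀ {T T' : Tableau}, IsTableau T → IsTableau T' →
    shape T = shape T' → T.map List.length = T'.map List.length
  | [], [], _, _, _ => rfl
  | [], _ :: _, _, h', h => absurd h.symm (shape_cons_ne_nil h'.1)
  | _ :: _, [], h', _, h => absurd h (shape_cons_ne_nil h'.1)
  | _ :: _, _ :: _, hT, hT', h => by
    obtain ⟨h1, h2⟩ := shape_cons_inj h
    simp [h1, hT.2.2.2.map_length_eq hT'.2.2.2 h2]

theorem headD_length_eq (T : Tableau) : (T.headD []).length = (T.getD 0 []).length := by
  cases T <;> rfl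

theorem IsTableau.length_succ_le : ∀ {T : Tableau}, IsTableau T → ∀ r : ℕ,
    (T.getD (r + 1) []).length ≤ (T.getD r []).length
  | [], _, _ => by simp
  | R :: Rs, h, 0 => by
    have := h.2.2.1.length_le
    rw [headD_length_eq] at this
    simpa using this
  | R :: Rs, h, r + 1 => by simpa using h.2.2.2.length_succ_le r

theorem IsTableau.isLowerSet {T : Tableau} (hT : IsTableau T) :
    IsLowerSet (shape T : Set (ℕ × ℕ)) := by
  rintro ⟨r, c⟩ ⟨r', c'⟩ ⟨hr, hc⟩ h
  simp only [Finset.mem_coe, mem_shape] at h ⊢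
  have : Antitone fun r => (T.getD r []).length := antitone_nat_of_succ_le hT.length_succ_le
  have := this hr
  simp only at this hc
  omega

theorem card_shape_cons (R : List ℕ) (Rs : Tableau) :
    (shape (R :: Rs)).card = R.length + (shape Rs).card := by
  have : shape (R :: Rs) = (Finset.range R.length).image (fun c => ((0 : ℕ), c)) ∪
      (shape Rs).image fun x => (x.1 + 1, x.2) := by
    ext ⟨r, c⟩
    cases r <;> simp
  rw [this, Finset.card_union_of_disjoint, Finset.card_image_of_injective,
    Finset.card_image_of_injective, Finset.card_range]
  · rintro ⟨a, b⟩ ⟨a', b'⟩ h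
    simpa using h
  · intro a b h
    simpa using h
  · rw [Finset.disjoint_left]
    intro x h h'
    rw [Finset.mem_image] at h h'
    obtain ⟨_, _, rfl⟩ := h
    obtain ⟨_, _, h'⟩ := h'
    simp at h'

theorem card_shape (T : Tableau) : (shape T).card = T.flatten.length := by
  induction T with
  | nil => rfl
  | cons R Rs ih => rw [card_shape_cons, ih]; simp

/-! ### Insertion -/

theorem rskInsert_cons_none {R : List ℕ} {Rs : Tableau} {x : ℕ} (h : (rowInsert x R).2 = none) :
    rskInsert (R :: Rs) x = (rowInsert x R).1 :: Rs := by
  have : rowInsert x R = ((rowInsert x R).1, none) := by rw [← h]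
  rw [rskInsert, this]

theorem rskInsert_cons_some {R : List ℕ} {Rs : Tableau} {x y : ℕ}
    (h : (rowInsert x R).2 = some y) :
    rskInsert (R :: Rs) x = (rowInsert x R).1 :: rskInsert Rs y := by
  have : rowInsert x R = ((rowInsert x R).1, some y) := by rw [← h]
  rw [rskInsert, this]

theorem headD_rskInsert (T : Tableau) (x : ℕ) :
    (rskInsert T x).headD [] = (rowInsert x (T.headD [])).1 := by
  cases T with
  | nil => rfl
  | cons R Rs =>
    cases h : (rowInsert x R).2 with
    | none => simp [rskInsert_cons_none h]
    | some y => simp [rskInsert_cons_some h]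

theorem rskInsert_perm (T : Tableau) (x : ℕ) :
    (rskInsert T x).flatten.Perm (x :: T.flatten) := by
  induction T generalizing x with
  | nil => simp [rskInsert]
  | cons R Rs ih =>
    have hp := rowInsert_perm x R
    cases h : (rowInsert x R).2 with
    | none =>
      rw [rskInsert_cons_none h]
      rw [h] at hp
      simpa using hp.append_right Rs.flatten
    | some y =>
      rw [rskInsert_cons_some h]
      rw [h] at hp
      simp only [List.flatten_cons]
      refine ((ih y).append_left _).trans ?_
      simpa using hp.append_right Rs.flatten

theorem Below.append_right : ∀ {R S : List ℕ} (U : List ℕ), Below R S → Below (R ++ U) S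
  | _, [], _, _ => by simp
  | [], _ :: _, _, h => absurd h (not_nil_below _ _)
  | _ :: _, _ :: _, U, h => ⟨h.1, h.2.append_right U⟩

theorem Below.of_append_right : ∀ {R S U : List ℕ}, Below R (S ++ U) → Below R S
  | _, [], _, _ => by simp
  | [], _ :: _, _, h => absurd h (not_nil_below _ _)
  | _ :: _, _ :: _, _, h => ⟨h.1, h.2.of_append_right⟩

theorem Below.of_append_left : ∀ {R S U : List ℕ}, Below (R ++ U) S → S.length ≤ R.length →
    Below R S
  | _, [], _, _, _ => by simp
  | [], _ :: _, _, _, hl => by simp at hl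
  | _ :: _, _ :: _, _, h, hl => ⟨h.1, h.2.of_append_left (by simpa using hl)⟩

/-- The removed entry `i` is at most every entry of `S`, so no entry of `S` can lie under it. -/
theorem Below.of_append_singleton {i : ℕ} : ∀ {R S : List ℕ}, Below (R ++ [i]) S →
    (∀ y ∈ S, i ≤ y) → Below R S
  | _, [], _, _ => by simp
  | [], y :: _, h, hS => by
    have := h.1
    have := hS y (by simp)
    omega
  | _ :: _, _ :: _, h, hS => ⟨h.1, h.2.of_append_singleton fun y hy => hS y (by simp [hy])⟩

theorem IsTableau.rskInsert {T : Tableau} (hT : IsTableau T) (hn : T.flatten.Nodup) {x : ℕ}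
    (hx : x ∉ T.flatten) : IsTableau (rskInsert T x) := by
  induction T generalizing x with
  | nil => simp [InvolutionNesting.rskInsert, IsTableau]
  | cons R Rs ih =>
    obtain ⟨h1, h2, h3, h4⟩ := hT
    simp only [List.flatten_cons, List.mem_append, not_or] at hx
    rw [List.flatten_cons, List.nodup_append] at hn
    have hne : (rowInsert x R).1 ≠ [] := List.ne_nil_of_mem (mem_rowInsert_self x R)
    cases h : (rowInsert x R).2 with
    | none =>
      rw [rskInsert_cons_none h]
      refine ⟨hne, pairwise_rowInsert h2 hx.1, ?_, h4⟩
      rw [(rowInsert_none h).1]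
      exact h3.append_right _
    | some y =>
      rw [rskInsert_cons_some h]
      refine ⟨hne, pairwise_rowInsert h2 hx.1, ?_, ih h4 hn.2.1 fun hy => ?_⟩
      · rw [headD_rskInsert]
        exact h3.rowInsert h2 h
      · exact hn.2.2 y (rowInsert_some_mem h).1 y hy rfl

theorem shape_rskInsert (T : Tableau) (x : ℕ) :
    ∃ c, c ∉ shape T ∧ shape (rskInsert T x) = insert c (shape T) := by
  induction T generalizing x with
  | nil =>
    refine ⟨(0, 0), by simp, ?_⟩
    ext ⟨r, c⟩
    cases r <;> simp [rskInsert]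
  | cons R Rs ih =>
    cases h : (rowInsert x R).2 with
    | none =>
      rw [rskInsert_cons_none h, (rowInsert_none h).1]
      refine ⟨(0, R.length), by simp, ?_⟩
      ext ⟨r, c⟩
      cases r with
      | zero => simp; omega
      | succ r => simp
    | some y =>
      rw [rskInsert_cons_some h]
      obtain ⟨⟨a, b⟩, h1, h2⟩ := ih y
      refine ⟨(a + 1, b), by simpa using h1, ?_⟩
      ext ⟨r, c⟩
      cases r with
      | zero => simp [rowInsert_some_length h]
      | succ r => simp [h2]

/-- A tableau before an insertion, and the inserted entry, are determined by its shape and the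
tableau after the insertion. -/
theorem rskInsert_inj {T₁ T₂ : Tableau} {x₁ x₂ : ℕ} (h₁ : IsTableau T₁) (h₂ : IsTableau T₂)
    (hs : shape T₁ = shape T₂) (h : rskInsert T₁ x₁ = rskInsert T₂ x₂) : x₁ = x₂ ∧ T₁ = T₂ := by
  induction T₁ generalizing T₂ x₁ x₂ with
  | nil =>
    cases T₂ with
    | nil => simpa [rskInsert] using h
    | cons R₂ Rs₂ => exact absurd hs.symm (shape_cons_ne_nil h₂.1)
  | cons R₁ Rs₁ ih =>
    cases T₂ with
    | nil => exact absurd hs (shape_cons_ne_nil h₁.1)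
    | cons R₂ Rs₂ =>
      obtain ⟨hl, hs'⟩ := shape_cons_inj hs
      cases e₁ : (rowInsert x₁ R₁).2 with
      | none =>
        rw [rskInsert_cons_none e₁, (rowInsert_none e₁).1] at h
        cases e₂ : (rowInsert x₂ R₂).2 with
        | none =>
          rw [rskInsert_cons_none e₂, (rowInsert_none e₂).1] at h
          simp only [List.cons.injEq] at h
          obtain ⟨h3, h4⟩ := List.append_inj h.1 hl
          simp only [List.cons.injEq, and_true] at h4
          exact ⟨h4, by rw [h3, h.2]⟩
        | some y₂ =>
          rw [rskInsert_cons_some e₂] at h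
          simp only [List.cons.injEq] at h
          have := congrArg List.length h.1
          rw [rowInsert_some_length e₂] at this
          simp at this
          omega
      | some y₁ =>
        rw [rskInsert_cons_some e₁] at h
        cases e₂ : (rowInsert x₂ R₂).2 with
        | none =>
          rw [rskInsert_cons_none e₂, (rowInsert_none e₂).1] at h
          simp only [List.cons.injEq] at h
          have := congrArg List.length h.1
          rw [rowInsert_some_length e₁] at this
          simp at this
          omega
        | some y₂ =>
          rw [rskInsert_cons_some e₂] at h
          simp only [List.cons.injEq] at h
          obtain ⟨rfl, rfl⟩ := ih h₁.2.2.2 h₂.2.2.2 hs' h.2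
          obtain ⟨rfl, rfl⟩ := rowInsert_inj_some h₁.2.1 h₂.2.1 e₁ e₂ h.1
          exact ⟨rfl, rfl⟩

/-- The bumping path is run backwards from the end of row `r`, which `hr` says is a corner: the
entry expelled from the lower rows is pushed back into the row above by reverse row insertion. -/
theorem exists_rskInsert_eq_erase {T : Tableau} (hT : IsTableau T) (hn : T.flatten.Nodup) {r : ℕ}
    (hr : (T.getD (r + 1) []).length < (T.getD r []).length) :
    ∃ T' x, IsTableau T' ∧ rskInsert T' x = T ∧
      shape T' = (shape T).erase (r, (T.getD r []).length - 1) := by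
  induction T generalizing r with
  | nil => simp at hr
  | cons R Rs ih =>
    obtain ⟨h1, h2, h3, h4⟩ := hT
    cases r with
    | zero =>
      obtain ⟨D, x, rfl⟩ : ∃ D x, R = D ++ [x] :=
        ⟨R.dropLast, R.getLast h1, (List.dropLast_append_getLast h1).symm⟩
      simp only [List.getD_cons_succ, List.getD_cons_zero, List.length_append,
        List.length_singleton] at hr
      rw [← headD_length_eq] at hr
      -- If the corner is the only cell of its row, there is no row below, and the row itself must
      -- disappear since tableaux have no empty rows.
      by_cases hD : D = []
      · subst hD
        have : Rs = [] := by
          cases Rs with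
          | nil => rfl
          | cons S _ =>
            have := h4.1
            simp at hr
            contradiction
        subst this
        refine ⟨[], x, trivial, rfl, ?_⟩
        ext ⟨a, b⟩
        cases a <;> simp
      · rw [List.pairwise_append] at h2
        have hge : ∀ a ∈ D, x ≤ a := fun a ha => (h2.2.2 a ha x (by simp)).le
        refine ⟨D :: Rs, x, ⟨hD, h2.1, h3.of_append_left (by omega), h4⟩, ?_, ?_⟩
        · have := rowInsert_append hge
          rw [rskInsert_cons_none (by rw [this]), this]
        · ext ⟨a, b⟩
          cases a with
          | zero => simp; omega
          | succ a => simp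
    | succ r =>
      rw [List.flatten_cons, List.nodup_append] at hn
      simp only [List.getD_cons_succ] at hr
      obtain ⟨Rs', y, t1, rfl, t3⟩ := ih h4 hn.2.1 hr
      have hp := rskInsert_perm Rs' y
      have hn' := hp.nodup hn.2.1
      rw [List.nodup_cons] at hn'
      have hyR : y ∉ R := fun h => hn.2.2 y h y (hp.symm.subset (by simp)) rfl
      rw [headD_rskInsert] at h3
      obtain ⟨a, ha, hlt⟩ := h3.exists_lt y (mem_rowInsert_self _ _)
      obtain ⟨R', x, hR', e⟩ := exists_rowInsert_eq h2 hyR ⟨a, ha, hlt⟩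
      have e2 : (rowInsert x R').2 = some y := by rw [e]
      have e1 : (rowInsert x R').1 = R := by rw [e]
      have hlen := rowInsert_some_length e2
      rw [e1] at hlen
      have hsub : (Rs'.headD []).Pairwise (· > ·) ∧ y ∉ Rs'.headD [] := by
        cases Rs' with
        | nil => simp
        | cons S Ss =>
          refine ⟨t1.2.1, fun h => hn'.1 ?_⟩
          simp only [List.headD_cons] at h
          simp [h]
      refine ⟨R' :: Rs', x, ⟨?_, hR', ?_, t1⟩, by rw [rskInsert_cons_some e2, e1], ?_⟩
      · exact List.ne_nil_of_mem (rowInsert_some_mem e2).1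
      · rw [← e1] at h3
        exact below_of_rowInsert hR' hsub.1 hsub.2 e2 h3
      · ext ⟨a, b⟩
        cases a with
        | zero => simp [hlen]
        | succ a => simp [t3]

/-- The corner of a tableau which is missing in a smaller diagram is at the end of a row. -/
theorem corner_of_insert {T : Tableau} {s : Finset (ℕ × ℕ)} {r c : ℕ}
    (hs : IsLowerSet (s : Set (ℕ × ℕ))) (hc : (r, c) ∉ s) (h : shape T = insert (r, c) s) :
    c + 1 = (T.getD r []).length ∧ (T.getD (r + 1) []).length ≤ c := by
  have h0 : (r, c) ∈ shape T := by simp [h]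
  have h1 : (r, c + 1) ∉ shape T := fun hm => by
    rw [h, Finset.mem_insert] at hm
    rcases hm with hm | hm
    · simp at hm
    · exact hc (hs (a := (r, c + 1)) (by simp [Prod.le_def]) hm)
  have h2 : (r + 1, c) ∉ shape T := fun hm => by
    rw [h, Finset.mem_insert] at hm
    rcases hm with hm | hm
    · simp at hm
    · exact hc (hs (a := (r + 1, c)) (by simp [Prod.le_def]) hm)
  rw [mem_shape] at h0 h1 h2
  omega

/-- Reverse insertion exists. -/
theorem exists_rskInsert_eq {T : Tableau} (hT : IsTableau T) (hn : T.flatten.Nodup)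
    {s : Finset (ℕ × ℕ)} (hs : IsLowerSet (s : Set (ℕ × ℕ))) {c : ℕ × ℕ} (hc : c ∉ s)
    (h : shape T = insert c s) : ∃ T' x, IsTableau T' ∧ rskInsert T' x = T ∧ shape T' = s := by
  obtain ⟨r, c⟩ := c
  obtain ⟨h1, h2⟩ := corner_of_insert hs hc h
  obtain ⟨T', x, t1, t2, t3⟩ := exists_rskInsert_eq_erase hT hn (r := r) (by omega)
  refine ⟨T', x, t1, t2, ?_⟩
  rw [t3, ← h1, h, Nat.add_sub_cancel, Finset.erase_insert hc]

/-! ### Deletion of the smallest entry -/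

/-- Add the entry `i` at the end of the row `r`. -/
def addAt : Tableau → ℕ → ℕ → Tableau
  | [], _, i => [[i]]
  | R :: Rs, 0, i => (R ++ [i]) :: Rs
  | R :: Rs, r + 1, i => R :: addAt Rs r i

theorem addAt_perm (T : Tableau) (r i : ℕ) : (addAt T r i).flatten.Perm (i :: T.flatten) := by
  induction T generalizing r with
  | nil => simp [addAt]
  | cons R Rs ih =>
    cases r with
    | zero => simp [addAt]
    | succ r =>
      simp only [addAt, List.flatten_cons]
      exact ((ih r).append_left R).trans (by simp)

theorem shape_addAt {T : Tableau} {r : ℕ} (hr : r ≤ T.length) (i : ℕ) :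
    shape (addAt T r i) = insert (r, (T.getD r []).length) (shape T) := by
  induction T generalizing r with
  | nil =>
    obtain rfl : r = 0 := by simpa using hr
    ext ⟨a, b⟩
    cases a <;> simp [addAt]
  | cons R Rs ih =>
    cases r with
    | zero =>
      ext ⟨a, b⟩
      cases a with
      | zero => simp [addAt]; omega
      | succ a => simp [addAt]
    | succ r =>
      have := ih (r := r) (by simpa using hr)
      ext ⟨a, b⟩
      cases a with
      | zero => simp [addAt]
      | succ a => simp [addAt, this]

theorem filter_ne_eq_self {l : List ℕ} {i : ℕ} (h : i ∉ l) : l.filter (fun y => y ≠ i) = l := by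
  rw [List.filter_eq_self]
  intro a ha
  simpa using fun h' : a = i => h (h' ▸ ha)

theorem tabDelete_cons (R : List ℕ) (Rs : Tableau) (i : ℕ) :
    tabDelete (R :: Rs) i = if R.filter (fun y => y ≠ i) = [] then tabDelete Rs i
      else R.filter (fun y => y ≠ i) :: tabDelete Rs i := by
  rw [tabDelete, List.map_cons, List.filter_cons]
  by_cases h : R.filter (fun y => y ≠ i) = []
  · rw [if_pos h, if_neg (by simpa using h)]; rfl
  · rw [if_neg h, if_pos (by simpa using h)]; rfl

theorem tabDelete_eq_self {T : Tableau} (hT : IsTableau T) {i : ℕ} (hi : i ∉ T.flatten) :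
    tabDelete T i = T := by
  induction T with
  | nil => rfl
  | cons R Rs ih =>
    simp only [List.flatten_cons, List.mem_append, not_or] at hi
    rw [tabDelete_cons, filter_ne_eq_self hi.1, if_neg hT.1, ih hT.2.2.2 hi.2]

theorem tabDelete_addAt {T : Tableau} (hT : IsTableau T) {i : ℕ} (hi : i ∉ T.flatten) (r : ℕ) :
    tabDelete (addAt T r i) i = T := by
  induction T generalizing r with
  | nil => simp [addAt, tabDelete]
  | cons R Rs ih =>
    have hi' := hi
    simp only [List.flatten_cons, List.mem_append, not_or] at hi
    cases r with
    | zero =>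
      rw [addAt, tabDelete_cons, List.filter_append, filter_ne_eq_self hi.1,
        tabDelete_eq_self hT.2.2.2 hi.2]
      simp [hT.1]
    | succ r =>
      rw [addAt, tabDelete_cons, filter_ne_eq_self hi.1, if_neg hT.1, ih hT.2.2.2 hi.2]

theorem headD_addAt (T : Tableau) (r i : ℕ) :
    (addAt T r i).headD [] = T.headD [] ∨ (addAt T r i).headD [] = T.headD [] ++ [i] := by
  cases T with
  | nil => simp [addAt]
  | cons R Rs => cases r <;> simp [addAt]

theorem Below.append_singleton {i : ℕ} : ∀ {R S : List ℕ}, Below R S → S.length < R.length →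
    (∀ a ∈ R, i < a) → Below R (S ++ [i])
  | [], _, _, hl, _ => by simp at hl
  | a :: _, [], _, _, h => ⟨h a (by simp), by simp⟩
  | _ :: _, _ :: _, hb, hl, h =>
    ⟨hb.1, hb.2.append_singleton (by simpa using hl) fun a ha => h a (by simp [ha])⟩

/-- An entry smaller than all others can be put at any addable place; `hr` says that the row above,
if there is one, is strictly longer. -/
theorem isTableau_addAt {T : Tableau} (hT : IsTableau T) {i : ℕ} (hi : ∀ y ∈ T.flatten, i < y)
    {r : ℕ} (hr : ∀ q, r = q + 1 → (T.getD r []).length < (T.getD q []).length) :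
    IsTableau (addAt T r i) := by
  induction T generalizing r with
  | nil => simp [addAt, IsTableau]
  | cons R Rs ih =>
    obtain ⟨h1, h2, h3, h4⟩ := hT
    simp only [List.flatten_cons, List.mem_append] at hi
    cases r with
    | zero =>
      refine ⟨by simp, ?_, h3.append_right _, h4⟩
      rw [List.pairwise_append]
      exact ⟨h2, by simp, by simpa using fun a ha => hi a (Or.inl ha)⟩
    | succ r =>
      refine ⟨h1, h2, ?_, ih h4 (fun y hy => hi y (Or.inr hy)) ?_⟩
      · cases r with
        | zero =>
          have hlt := hr 0 rfl
          simp only [List.getD_cons_succ, List.getD_cons_zero] at hlt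
          rw [← headD_length_eq] at hlt
          have : (addAt Rs 0 i).headD [] = Rs.headD [] ++ [i] := by cases Rs <;> rfl
          rw [this]
          exact h3.append_singleton hlt fun a ha => hi a (Or.inl ha)
        | succ r =>
          cases Rs with
          | nil =>
            have hlt := hr (r + 1) rfl
            simp at hlt
          | cons S Ss => simpa [addAt] using h3
      · rintro q rfl
        simpa using hr (q + 1) rfl

/-- The smallest entry of a tableau can be deleted; it is at the end of a row. -/
theorem tabDelete_min {T : Tableau} (hT : IsTableau T) (hn : T.flatten.Nodup) {i : ℕ}
    (hi : i ∈ T.flatten) (hmin : ∀ y ∈ T.flatten, i ≤ y) :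
    IsTableau (tabDelete T i) ∧ ∃ r ≤ (tabDelete T i).length, T = addAt (tabDelete T i) r i := by
  induction T with
  | nil => simp at hi
  | cons R Rs ih =>
    obtain ⟨h1, h2, h3, h4⟩ := hT
    rw [List.flatten_cons, List.nodup_append] at hn
    simp only [List.flatten_cons, List.mem_append] at hi hmin
    by_cases hR : i ∈ R
    · have hRs : i ∉ Rs.flatten := fun h => hn.2.2 i hR i h rfl
      obtain ⟨D, x, rfl⟩ : ∃ D x, R = D ++ [x] :=
        ⟨R.dropLast, R.getLast h1, (List.dropLast_append_getLast h1).symm⟩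
      rw [List.pairwise_append] at h2
      obtain rfl : x = i := by
        rcases List.mem_append.1 hR with h | h
        · have := h2.2.2 i h x (by simp)
          have := hmin x (by simp)
          omega
        · simpa using (List.mem_singleton.1 h).symm
      have hD : x ∉ D := fun h => lt_irrefl _ (h2.2.2 x h x (by simp))
      have hb : Below D (Rs.headD []) := h3.of_append_singleton fun y hy => by
        refine hmin y (Or.inr ?_)
        cases Rs with
        | nil => simp at hy
        | cons S Ss =>
          simp only [List.headD_cons] at hy
          simp [hy]
      rw [tabDelete_cons, List.filter_append, filter_ne_eq_self hD, tabDelete_eq_self h4 hRs]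
      simp only [List.append_eq_nil_iff]
      by_cases hDn : D = []
      · subst hDn
        have : Rs = [] := by
          cases Rs with
          | nil => rfl
          | cons S Ss =>
            have h5 := h4.1
            have := hb.length_le
            simp at this
            contradiction
        subst this
        simp [IsTableau, addAt]
      · simp only [hDn, false_and, if_false]
        refine ⟨⟨by simp [hDn], by simpa using h2.1, by simpa using hb, h4⟩, 0, by simp, ?_⟩
        simp [addAt]
    · rcases hi with hi | hi
      · exact absurd hi hR
      obtain ⟨t1, r, hr, t2⟩ := ih h4 hn.2.1 hi fun y hy => hmin y (Or.inr hy)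
      rw [tabDelete_cons, filter_ne_eq_self hR, if_neg h1]
      refine ⟨⟨h1, h2, ?_, t1⟩, r + 1, by simpa using hr, by rw [addAt, ← t2]⟩
      rw [t2] at h3
      rcases headD_addAt (tabDelete Rs i) r i with h | h <;> rw [h] at h3
      · exact h3
      · exact h3.of_append_right

theorem not_mem_shape_length (T : Tableau) (r : ℕ) : (r, (T.getD r []).length) ∉ shape T := by
  simp [mem_shape]

theorem shape_tabDelete {T : Tableau} (hT : IsTableau T) (hn : T.flatten.Nodup) {i : ℕ}
    (hi : i ∈ T.flatten) (hmin : ∀ y ∈ T.flatten, i ≤ y) :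
    ∃ c, c ∉ shape (tabDelete T i) ∧ shape T = insert c (shape (tabDelete T i)) := by
  obtain ⟨_, r, hr, h⟩ := tabDelete_min hT hn hi hmin
  refine ⟨_, not_mem_shape_length _ r, ?_⟩
  conv_lhs => rw [h]
  exact shape_addAt hr i

/-- The position of the deleted minimum is the cell by which the two shapes differ. -/
theorem tabDelete_inj {T₁ T₂ : Tableau} (h₁ : IsTableau T₁) (h₂ : IsTableau T₂)
    (hn₁ : T₁.flatten.Nodup) (hn₂ : T₂.flatten.Nodup) {i : ℕ} (hi₁ : i ∈ T₁.flatten)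
    (hi₂ : i ∈ T₂.flatten) (hmin₁ : ∀ y ∈ T₁.flatten, i ≤ y) (hmin₂ : ∀ y ∈ T₂.flatten, i ≤ y)
    (hs : shape T₁ = shape T₂) (h : tabDelete T₁ i = tabDelete T₂ i) : T₁ = T₂ := by
  obtain ⟨_, r₁, hr₁, e₁⟩ := tabDelete_min h₁ hn₁ hi₁ hmin₁
  obtain ⟨_, r₂, hr₂, e₂⟩ := tabDelete_min h₂ hn₂ hi₂ hmin₂
  rw [h] at e₁ hr₁
  have hs := (shape_addAt hr₁ i).symm.trans
    ((congrArg shape e₁.symm).trans (hs.trans ((congrArg shape e₂).trans (shape_addAt hr₂ i))))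
  have hm : (r₁, ((tabDelete T₂ i).getD r₁ []).length) ∈
      insert (r₂, ((tabDelete T₂ i).getD r₂ []).length) (shape (tabDelete T₂ i)) := by
    rw [← hs]; simp
  rw [Finset.mem_insert] at hm
  rcases hm with hm | hm
  · exact e₁.trans ((Prod.mk.inj hm).1 ▸ e₂.symm)
  · exact absurd hm (not_mem_shape_length _ _)

/-- Reverse deletion exists. -/
theorem exists_tabDelete_eq {D : Tableau} (hD : IsTableau D) {i : ℕ}
    (hi : ∀ y ∈ D.flatten, i < y) {s : Finset (ℕ × ℕ)} (hs : IsLowerSet (s : Set (ℕ × ℕ)))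
    {c : ℕ × ℕ} (hc : c ∉ shape D) (h : s = insert c (shape D)) :
    ∃ T, IsTableau T ∧ tabDelete T i = D ∧ shape T = s ∧ T.flatten.Perm (i :: D.flatten) := by
  obtain ⟨r, c⟩ := c
  have hlow := hs
  have h0 : (r, c) ∈ s := by simp [h]
  -- Because `s` is a lower set, the cells above and to the left of the new one are already in `D`.
  -- This makes the new cell the end of row `r`, with a longer row above it.
  have key : ∀ a b, a ≤ r → b ≤ c → (a, b) ≠ (r, c) → (a, b) ∈ shape D := by
    intro a b ha hb hne
    have hm : (a, b) ∈ s := hs (a := (r, c)) (by simp [Prod.le_def, ha, hb]) h0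
    rw [h, Finset.mem_insert] at hm
    exact hm.resolve_left hne
  rw [mem_shape] at hc
  have hcl : c = (D.getD r []).length := by
    rcases Nat.eq_zero_or_pos c with rfl | hpos
    · omega
    · have := key r (c - 1) le_rfl (by omega) (by simp; omega)
      rw [mem_shape] at this
      omega
  have hq : ∀ q, r = q + 1 → (D.getD r []).length < (D.getD q []).length := by
    rintro q rfl
    have := key q c (by omega) le_rfl (by simp)
    rw [mem_shape] at this
    omega
  have hrl : r ≤ D.length := by
    by_contra hlt
    have := hq (r - 1) (by omega)
    rw [List.getD_eq_default (n := r - 1) _ _ (by omega)] at this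
    simp at this
  refine ⟨addAt D r i, isTableau_addAt hD hi hq, tabDelete_addAt hD (fun h => lt_irrefl _ (hi i h)) r,
    ?_, addAt_perm D r i⟩
  rw [shape_addAt hrl, h, hcl]

/-! ### Knuth equivalence -/

/-- The elementary Knuth transformations. -/
inductive KnuthStep : List ℕ → List ℕ → Prop
  | left (u v : List ℕ) {a b c : ℕ} (hab : a < b) (hbc : b < c) :
      KnuthStep (u ++ [b, a, c] ++ v) (u ++ [b, c, a] ++ v)
  | right (u v : List ℕ) {a b c : ℕ} (hab : a < b) (hbc : b < c) :
      KnuthStep (u ++ [a, c, b] ++ v) (u ++ [c, a, b] ++ v)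

/-- Knuth equivalence of words. -/
def Knuth : List ℕ → List ℕ → Prop := Relation.EqvGen KnuthStep

theorem KnuthStep.append {w w' : List ℕ} (h : KnuthStep w w') (x y : List ℕ) :
    KnuthStep (x ++ w ++ y) (x ++ w' ++ y) := by
  cases h with
  | left u v hab hbc => simpa using KnuthStep.left (x ++ u) (v ++ y) hab hbc
  | right u v hab hbc => simpa using KnuthStep.right (x ++ u) (v ++ y) hab hbc

theorem Knuth.refl (w : List ℕ) : Knuth w w := Relation.EqvGen.refl w

theorem Knuth.symm {w w' : List ℕ} (h : Knuth w w') : Knuth w' w := Relation.EqvGen.symm _ _ h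

theorem Knuth.trans {w w' w'' : List ℕ} (h : Knuth w w') (h' : Knuth w' w'') : Knuth w w'' :=
  Relation.EqvGen.trans _ _ _ h h'

theorem KnuthStep.knuth {w w' : List ℕ} (h : KnuthStep w w') : Knuth w w' :=
  Relation.EqvGen.rel _ _ h

theorem Knuth.append {w w' : List ℕ} (h : Knuth w w') (x y : List ℕ) :
    Knuth (x ++ w ++ y) (x ++ w' ++ y) := by
  induction h with
  | rel _ _ h => exact (h.append x y).knuth
  | refl _ => exact Knuth.refl _
  | symm _ _ _ ih => exact ih.symm
  | trans _ _ _ _ _ ih ih' => exact ih.trans ih'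

theorem Knuth.append_left {w w' : List ℕ} (h : Knuth w w') (x : List ℕ) :
    Knuth (x ++ w) (x ++ w') := by simpa using h.append x []

theorem Knuth.append_right {w w' : List ℕ} (h : Knuth w w') (y : List ℕ) :
    Knuth (w ++ y) (w' ++ y) := by simpa using h.append [] y

/-- A Knuth step moves the smallest letter `a` past the largest letter `c`. If `a` is dropped, both
sides become equal; otherwise all three letters are kept. -/
theorem KnuthStep.filter {w w' : List ℕ} (h : KnuthStep w w') (i : ℕ) :
    Knuth (w.filter (i < ·)) (w'.filter (i < ·)) := by
  cases h with
  | @left u v a b c hab hbc =>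
    by_cases ha : i < a
    · have hb : i < b := ha.trans hab
      have hc : i < c := hb.trans hbc
      simpa [ha, hb, hc] using (KnuthStep.left (u.filter (i < ·)) (v.filter (i < ·)) hab hbc).knuth
    · by_cases hc : i < c <;> simpa [List.filter_cons, ha, hc] using Knuth.refl _
  | @right u v a b c hab hbc =>
    by_cases ha : i < a
    · have hb : i < b := ha.trans hab
      have hc : i < c := hb.trans hbc
      simpa [ha, hb, hc] using (KnuthStep.right (u.filter (i < ·)) (v.filter (i < ·)) hab hbc).knuth
    · by_cases hc : i < c <;> simpa [List.filter_cons, ha, hc] using Knuth.refl _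

theorem Knuth.filter {w w' : List ℕ} (h : Knuth w w') (i : ℕ) :
    Knuth (w.filter (i < ·)) (w'.filter (i < ·)) := by
  induction h with
  | rel _ _ h => exact h.filter i
  | refl _ => exact Knuth.refl _
  | symm _ _ _ ih => exact ih.symm
  | trans _ _ _ _ _ ih ih' => exact ih.trans ih'

/-- The reading word of a tableau: rows are read from left to right, starting from the last
one. -/
def reading : Tableau → List ℕ
  | [] => []
  | R :: Rs => reading Rs ++ R

theorem reading_perm (T : Tableau) : (reading T).Perm T.flatten := by
  induction T with
  | nil => simp [reading]
  | cons R Rs ih =>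
    simp only [reading, List.flatten_cons]
    exact List.perm_append_comm.trans (ih.append_left R)

theorem reading_tabDelete (T : Tableau) (i : ℕ) :
    reading (tabDelete T i) = (reading T).filter fun y => y ≠ i := by
  induction T with
  | nil => rfl
  | cons R Rs ih =>
    rw [tabDelete_cons, reading, List.filter_append, ← ih]
    split_ifs with h
    · rw [h, List.append_nil]
    · rfl

/-- The letter `x` moves to the left past the entries of `R` one by one; the entry preceding the one
it passes has an intermediate value and serves as the witness. -/
theorem knuth_bump {a x : ℕ} : ∀ {R : List ℕ}, R.Pairwise (· > ·) → (∀ b ∈ R, b < a) → a < x →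
    Knuth (a :: R ++ [x]) (a :: x :: R)
  | [], _, _, _ => Knuth.refl _
  | b :: R, hR, hb, hax => by
    rw [List.pairwise_cons] at hR
    have hba := hb b (by simp)
    have h1 := (knuth_bump hR.2 hR.1 (hba.trans hax)).append_left [a]
    have h2 := (KnuthStep.left [] R hba hax).knuth
    exact Knuth.trans (by simpa using h1) (by simpa using h2)

theorem head_rowInsert {x y : ℕ} {R : List ℕ} (hR : R.Pairwise (· > ·))
    (h : (rowInsert x R).2 = some y) :
    ∃ z L, (rowInsert x R).1 = z :: L ∧ y < z ∧ (z = x ∨ z ∈ R) := by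
  cases R with
  | nil => simp [rowInsert] at h
  | cons b R =>
    rw [rowInsert_cons] at h ⊢
    split_ifs at h ⊢ with hb
    · simp only [Option.some.injEq] at h
      subst h
      exact ⟨x, R, rfl, hb, Or.inl rfl⟩
    · exact ⟨b, _, rfl, List.rel_of_pairwise_cons hR (rowInsert_some_mem h).1, Or.inr (by simp)⟩

/-- First `x` travels left until it is just behind the entry `y` that it bumps (`knuth_bump`); then
`y` travels to the front past larger entries, its right neighbour being the intermediate letter. -/
theorem knuth_rowInsert {x y : ℕ} : ∀ {R : List ℕ}, R.Pairwise (· > ·) → x ∉ R →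
    (rowInsert x R).2 = some y → Knuth (R ++ [x]) (y :: (rowInsert x R).1)
  | [], _, _, h => by simp [rowInsert] at h
  | a :: R, hR, hx, h => by
    simp only [List.mem_cons, not_or] at hx
    rw [List.pairwise_cons] at hR
    rw [rowInsert_cons] at h ⊢
    split_ifs at h ⊢ with hax
    · simp only [Option.some.injEq] at h
      subst h
      exact knuth_bump hR.2 hR.1 hax
    · have h1 := (knuth_rowInsert hR.2 hx.2 h).append_left [a]
      obtain ⟨z, L, e, hyz, hz⟩ := head_rowInsert hR.2 h
      have hza : z < a := by
        rcases hz with rfl | hz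
        · omega
        · exact hR.1 z hz
      have h2 := (KnuthStep.right [] L hyz hza).knuth.symm
      rw [e] at h1 ⊢
      exact Knuth.trans (by simpa using h1) (by simpa using h2)

/-- Insertion of `x` is compatible with Knuth equivalence. -/
theorem knuth_rskInsert {T : Tableau} (hT : IsTableau T) (hn : T.flatten.Nodup) {x : ℕ}
    (hx : x ∉ T.flatten) : Knuth (reading T ++ [x]) (reading (rskInsert T x)) := by
  induction T generalizing x with
  | nil => exact Knuth.refl _
  | cons R Rs ih =>
    obtain ⟨h1, h2, h3, h4⟩ := hT
    simp only [List.flatten_cons, List.mem_append, not_or] at hx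
    rw [List.flatten_cons, List.nodup_append] at hn
    cases h : (rowInsert x R).2 with
    | none =>
      rw [rskInsert_cons_none h, (rowInsert_none h).1, reading, reading, List.append_assoc]
      exact Knuth.refl _
    | some y =>
      rw [rskInsert_cons_some h, reading, reading]
      have hy : y ∉ Rs.flatten := fun hy => hn.2.2 y (rowInsert_some_mem h).1 y hy rfl
      have k1 := (knuth_rowInsert h2 hx.1 h).append_left (reading Rs)
      have k2 := (ih h4 hn.2.1 hy).append_right (rowInsert x R).1
      exact Knuth.trans (by simpa using k1) (by simpa using k2)

/-! ### Monotone subsequences -/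

/-- The word `w` has a subsequence of length `k` which is a chain for `r`. -/
def HasChain (r : ℕ → ℕ → Prop) (k : ℕ) (w : List ℕ) : Prop :=
  ∃ l : List ℕ, l.Sublist w ∧ l.Pairwise r ∧ l.length = k

theorem HasChain.mono {r : ℕ → ℕ → Prop} {k k' : ℕ} {w : List ℕ} (h : HasChain r k w)
    (hk : k' ≤ k) : HasChain r k' w := by
  obtain ⟨l, h1, h2, h3⟩ := h
  exact ⟨l.take k', (List.take_sublist _ _).trans h1, h2.sublist (List.take_sublist _ _),
    by simp; omega⟩

/-- Chains of `m` can be replaced by chains of `m'` in any context. -/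
def ChainReplace (r : ℕ → ℕ → Prop) (m m' : List ℕ) : Prop :=
  ∀ l : List ℕ, l.Sublist m → l.Pairwise r → ∃ l' : List ℕ, l'.Sublist m' ∧ l'.Pairwise r ∧
    l'.length = l.length ∧ (∀ x, (∀ y ∈ l, r x y) → ∀ y ∈ l', r x y) ∧
    ∀ x, (∀ y ∈ l, r y x) → ∀ y ∈ l', r y x

theorem HasChain.replace {r : ℕ → ℕ → Prop} {m m' : List ℕ} (hm : ChainReplace r m m') {k : ℕ}
    {u v : List ℕ} (h : HasChain r k (u ++ m ++ v)) : HasChain r k (u ++ m' ++ v) := by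
  obtain ⟨l, h1, h2, h3⟩ := h
  obtain ⟨l₀, l₃, rfl, s₀, s₃⟩ := List.sublist_append_iff.1 h1
  obtain ⟨l₁, l₂, rfl, s₁, s₂⟩ := List.sublist_append_iff.1 s₀
  simp only [List.pairwise_append, List.mem_append] at h2
  obtain ⟨⟨p1, p2, p3⟩, p4, p5⟩ := h2
  obtain ⟨l', q1, q2, q3, q4, q5⟩ := hm l₂ s₂ p2
  refine ⟨l₁ ++ l' ++ l₃, (s₁.append q1).append s₃, ?_, by simpa [q3] using h3⟩
  simp only [List.pairwise_append, List.mem_append]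
  refine ⟨⟨p1, q2, fun a ha => q4 a (p3 a ha)⟩, p4, ?_⟩
  rintro a (ha | ha) b hb
  · exact p5 a (Or.inl ha) b hb
  · exact q5 b (fun y hy => p5 y (Or.inr hy) b hb) a ha

section
variable {r : ℕ → ℕ → Prop} [Std.Asymm r] [IsTrans ℕ r] {a b c : ℕ}

/-- Only the chain `[a, c]` is lost by the swap, and `[b, c]` replaces it. The order is abstract so
that the four lemmas serve both `<` and `>`: reversing the order exchanges `a` and `c`, which turns
each Knuth step around. -/
theorem chainReplace_bac (hab : r a b) (hbc : r b c) : ChainReplace r [b, a, c] [b, c, a] := by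
  intro l hl hp
  have hba : ¬ r b a := asymm hab
  by_cases hl' : l = [a, c]
  · subst hl'
    refine ⟨[b, c], by simp, by simpa using hbc, rfl, ?_, ?_⟩
    · intro x hx
      simp only [List.mem_cons, List.not_mem_nil, or_false, forall_eq_or_imp, forall_eq] at hx ⊢
      exact ⟨_root_.trans hx.1 hab, hx.2⟩
    · intro x hx
      simp only [List.mem_cons, List.not_mem_nil, or_false, forall_eq_or_imp, forall_eq] at hx ⊢
      exact ⟨_root_.trans hbc hx.2, hx.2⟩
  · refine ⟨l, ?_, hp, rfl, fun _ h => h, fun _ h => h⟩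
    have := List.mem_sublists'.2 hl
    simp only [List.sublists'_cons, List.sublists'_nil, List.map_cons, List.map_nil,
      List.mem_cons, List.not_mem_nil, or_false, List.cons_append, List.nil_append] at this
    rcases this with rfl | rfl | rfl | rfl | rfl | rfl | rfl | rfl <;>
      first
      | (simp [hba] at hp; done)
      | (simp at hl'; done)
      | simp

/-- In this direction no chain is lost, since `c` before `a` was not a chain. -/
theorem chainReplace_bca (hab : r a b) (hbc : r b c) : ChainReplace r [b, c, a] [b, a, c] := by
  intro l hl hp
  have hba : ¬ r b a := asymm hab
  have hca : ¬ r c a := asymm (_root_.trans hab hbc)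
  refine ⟨l, ?_, hp, rfl, fun _ h => h, fun _ h => h⟩
  have := List.mem_sublists'.2 hl
  simp only [List.sublists'_cons, List.sublists'_nil, List.map_cons, List.map_nil,
    List.mem_cons, List.not_mem_nil, or_false, List.cons_append, List.nil_append] at this
  rcases this with rfl | rfl | rfl | rfl | rfl | rfl | rfl | rfl <;>
    first
    | (simp [hba, hca] at hp; done)
    | simp

/-- Again only `[a, c]` is lost; here `[a, b]` replaces it. -/
theorem chainReplace_acb (hab : r a b) (hbc : r b c) : ChainReplace r [a, c, b] [c, a, b] := by
  intro l hl hp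
  have hcb : ¬ r c b := asymm hbc
  by_cases hl' : l = [a, c]
  · subst hl'
    refine ⟨[a, b], by simp, by simpa using hab, rfl, ?_, ?_⟩
    · intro x hx
      simp only [List.mem_cons, List.not_mem_nil, or_false, forall_eq_or_imp, forall_eq] at hx ⊢
      exact ⟨hx.1, _root_.trans hx.1 hab⟩
    · intro x hx
      simp only [List.mem_cons, List.not_mem_nil, or_false, forall_eq_or_imp, forall_eq] at hx ⊢
      exact ⟨hx.1, _root_.trans hbc hx.2⟩
  · refine ⟨l, ?_, hp, rfl, fun _ h => h, fun _ h => h⟩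
    have := List.mem_sublists'.2 hl
    simp only [List.sublists'_cons, List.sublists'_nil, List.map_cons, List.map_nil,
      List.mem_cons, List.not_mem_nil, or_false, List.cons_append, List.nil_append] at this
    rcases this with rfl | rfl | rfl | rfl | rfl | rfl | rfl | rfl <;>
      first
      | (simp [hcb] at hp; done)
      | (simp at hl'; done)
      | simp

theorem chainReplace_cab (hab : r a b) (hbc : r b c) : ChainReplace r [c, a, b] [a, c, b] := by
  intro l hl hp
  have hcb : ¬ r c b := asymm hbc
  have hca : ¬ r c a := asymm (_root_.trans hab hbc)
  refine ⟨l, ?_, hp, rfl, fun _ h => h, fun _ h => h⟩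
  have := List.mem_sublists'.2 hl
  simp only [List.sublists'_cons, List.sublists'_nil, List.map_cons, List.map_nil,
    List.mem_cons, List.not_mem_nil, or_false, List.cons_append, List.nil_append] at this
  rcases this with rfl | rfl | rfl | rfl | rfl | rfl | rfl | rfl <;>
    first
    | (simp [hcb, hca] at hp; done)
    | simp

end

theorem Knuth.hasChain_lt_iff {w w' : List ℕ} (h : Knuth w w') (k : ℕ) :
    HasChain (· < ·) k w ↔ HasChain (· < ·) k w' := by
  induction h with
  | rel _ _ h =>
    cases h with
    | left u v hab hbc =>
      exact ⟨.replace (chainReplace_bac hab hbc), .replace (chainReplace_bca hab hbc)⟩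
    | right u v hab hbc =>
      exact ⟨.replace (chainReplace_acb hab hbc), .replace (chainReplace_cab hab hbc)⟩
  | refl _ => exact Iff.rfl
  | symm _ _ _ ih => exact ih.symm
  | trans _ _ _ _ _ ih ih' => exact ih.trans ih'

theorem Knuth.hasChain_gt_iff {w w' : List ℕ} (h : Knuth w w') (k : ℕ) :
    HasChain (· > ·) k w ↔ HasChain (· > ·) k w' := by
  induction h with
  | rel _ _ h =>
    cases h with
    | @left u v a b c hab hbc =>
      have hab : b > a := hab
      have hbc : c > b := hbc
      exact ⟨.replace (chainReplace_bca hbc hab), .replace (chainReplace_bac hbc hab)⟩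
    | @right u v a b c hab hbc =>
      have hab : b > a := hab
      have hbc : c > b := hbc
      exact ⟨.replace (chainReplace_cab hbc hab), .replace (chainReplace_acb hbc hab)⟩
  | refl _ => exact Iff.rfl
  | symm _ _ _ ih => exact ih.symm
  | trans _ _ _ _ _ ih ih' => exact ih.trans ih'

/-! ### Longest monotone subsequences in the reading word of a tableau -/

theorem Below.countP_le {q : ℕ → Bool} (hq : ∀ x y, y < x → q y → q x) : ∀ {R S : List ℕ},
    Below R S → S.countP q ≤ R.countP q
  | _, [], _ => by simp
  | [], _ :: _, h => absurd h (not_nil_below _ _)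
  | x :: xs, y :: ys, h => by
    rw [List.countP_cons, List.countP_cons]
    have h1 := h.2.countP_le hq
    have h2 := hq x y h.1
    split_ifs <;> simp_all
    omega

/-- The threshold `v` makes the induction on rows work. If `u` is the first letter taken from the
top row, the letters taken from lower rows exceed `u` and are, by induction, no more numerous than
the entries above `u` in the top row; the remaining letters are entries of the top row between `v`
and `u`. -/
theorem length_le_countP {T : Tableau} (hT : IsTableau T) {l : List ℕ}
    (hl : l.Sublist (reading T)) (hp : l.Pairwise (· > ·)) (v : ℕ) (hv : ∀ x ∈ l, v ≤ x) :
    l.length ≤ (T.headD []).countP (v ≤ ·) := by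
  induction T generalizing l v with
  | nil =>
    rw [reading, List.sublist_nil] at hl
    simp [hl]
  | cons R Rs ih =>
    obtain ⟨l₁, l₂, rfl, s₁, s₂⟩ := List.sublist_append_iff.1 hl
    rw [List.pairwise_append] at hp
    simp only [List.headD_cons, List.length_append]
    have hup : ∀ u x y : ℕ, y < x → decide (u ≤ y) = true → decide (u ≤ x) = true := by
      intro u x y h
      simp only [decide_eq_true_eq]
      omega
    cases l₂ with
    | nil =>
      have h1 := ih hT.2.2.2 s₁ hp.1 v fun x hx => hv x (by simp [hx])
      exact h1.trans (hT.2.2.1.countP_le (hup v))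
    | cons u l₂ =>
      have h1 := ih hT.2.2.2 s₁ hp.1 (u + 1) fun x hx => hp.2.2 x hx u (by simp)
      have h2 := h1.trans (hT.2.2.1.countP_le (hup (u + 1)))
      have h3 : (u :: l₂).length ≤ (R.filter fun x => x ≤ u).countP (v ≤ ·) := by
        rw [List.countP_eq_length_filter, List.filter_filter]
        have : (u :: l₂).filter (fun x => decide (v ≤ x) && decide (x ≤ u)) = u :: l₂ := by
          rw [List.filter_eq_self]
          intro x hx
          have h4 := hv x (by simp only [List.mem_append]; exact Or.inr hx)
          have h5 : x ≤ u := by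
            rcases List.mem_cons.1 hx with rfl | hx
            · exact le_rfl
            · exact (List.rel_of_pairwise_cons hp.2.1 hx).le
          simp [h4, h5]
        calc (u :: l₂).length = _ := by rw [← congrArg List.length this]
          _ ≤ _ := (s₂.filter _).length_le
      have h4 : R.countP (v ≤ ·) = (R.filter fun x => x ≤ u).countP (v ≤ ·) +
          (R.filter fun x => ¬ x ≤ u).countP (v ≤ ·) := by
        rw [List.countP_filter, List.countP_filter]
        clear * -
        induction R with
        | nil => rfl
        | cons a R ih =>
          simp only [List.countP_cons, ih]
          by_cases h : a ≤ u <;> by_cases h' : v ≤ a <;> simp [h, h'] <;> omega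
      have h5 : (R.filter fun x => ¬ x ≤ u).countP (v ≤ ·) = R.countP (u + 1 ≤ ·) := by
        rw [List.countP_filter]
        apply List.countP_congr
        intro x _
        have := hv u (by simp)
        simp
        omega
      omega

/-- Longest decreasing subsequences of the reading word of a tableau. -/
theorem hasChain_gt_reading {T : Tableau} (hT : IsTableau T) (k : ℕ) :
    HasChain (· > ·) k (reading T) ↔ k ≤ (T.headD []).length := by
  constructor
  · rintro ⟨l, h1, h2, rfl⟩
    exact (length_le_countP hT h1 h2 0 (by simp)).trans List.countP_le_length
  · intro hk
    refine HasChain.mono ⟨T.headD [], ?_, ?_, rfl⟩ hk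
    · cases T with
      | nil => exact List.Sublist.refl _
      | cons R Rs => exact List.sublist_append_right _ _
    · cases T with
      | nil => simp
      | cons R Rs => exact hT.2.1

/-- The chain is the first column, read from bottom to top. -/
theorem exists_chain_lt_reading {R : List ℕ} {Rs : Tableau} (hT : IsTableau (R :: Rs)) :
    ∃ l : List ℕ, l.Sublist (reading (R :: Rs)) ∧ l.Pairwise (· < ·) ∧
      l.length = (R :: Rs).length ∧ ∀ x ∈ l, x ≤ R.headD 0 := by
  induction Rs generalizing R with
  | nil =>
    obtain ⟨a, L, rfl⟩ := List.exists_cons_of_ne_nil hT.1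
    exact ⟨[a], by simp [reading], by simp, rfl, by simp⟩
  | cons S Ss ih =>
    obtain ⟨l, h1, h2, h3, h4⟩ := ih hT.2.2.2
    obtain ⟨a, L, rfl⟩ := List.exists_cons_of_ne_nil hT.1
    obtain ⟨b, M, rfl⟩ := List.exists_cons_of_ne_nil hT.2.2.2.1
    have hba : b < a := hT.2.2.1.1
    simp only [List.headD_cons] at h4 ⊢
    refine ⟨l ++ [a], ?_, ?_, by simpa using h3, ?_⟩
    · rw [reading]
      exact h1.append (by simp)
    · rw [List.pairwise_append]
      refine ⟨h2, by simp, fun x hx y hy => ?_⟩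
      rw [List.mem_singleton] at hy
      subst hy
      exact (h4 x hx).trans_lt hba
    · intro x hx
      rcases List.mem_append.1 hx with hx | hx
      · exact (h4 x hx).trans hba.le
      · exact (List.mem_singleton.1 hx).le

/-- Longest increasing subsequences of the reading word of a tableau. -/
theorem hasChain_lt_reading {T : Tableau} (hT : IsTableau T) (k : ℕ) :
    HasChain (· < ·) k (reading T) ↔ k ≤ T.length := by
  constructor
  · rintro ⟨l, h1, h2, rfl⟩
    induction T generalizing l with
    | nil =>
      rw [reading, List.sublist_nil] at h1
      simp [h1]
    | cons R Rs ih =>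
      obtain ⟨l₁, l₂, rfl, s₁, s₂⟩ := List.sublist_append_iff.1 h1
      rw [List.pairwise_append] at h2
      have h3 := ih hT.2.2.2 l₁ s₁ h2.1
      -- A row is decreasing, so it contributes at most one letter to an increasing subsequence.
      have h4 : l₂.length ≤ 1 := by
        have h5 := hT.2.1.sublist s₂
        match l₂, h2.2.1, h5 with
        | [], _, _ => simp
        | [_], _, _ => simp
        | a :: b :: _, h6, h7 =>
          have h8 := List.rel_of_pairwise_cons h6 (List.mem_cons_self (a := b))
          have h9 := List.rel_of_pairwise_cons h7 (List.mem_cons_self (a := b))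
          omega
      simp only [List.length_append, List.length_cons]
      omega
  · intro hk
    cases T with
    | nil => exact ⟨[], by simp, by simp, (Nat.le_zero.1 hk).symm⟩
    | cons R Rs =>
      obtain ⟨l, h1, h2, h3, _⟩ := exists_chain_lt_reading hT
      exact HasChain.mono ⟨l, h1, h2, h3⟩ hk

/-! ### Tableau sequences of partial matchings -/

/-- The tableau after `t` full steps. -/
def tab (p : ℕ → ℕ) (t : ℕ) : Tableau := tableauSeq p (2 * t)

theorem tableauSeq_odd (p : ℕ → ℕ) (t : ℕ) :
    tableauSeq p (2 * t + 1) = if p t < t then tabDelete (tab p t) t else tab p t := by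
  rw [tableauSeq, if_pos (by omega), Nat.mul_div_cancel_left _ (by norm_num)]
  rfl

theorem tab_succ (p : ℕ → ℕ) (t : ℕ) :
    tab p (t + 1) = if p t < t then tabDelete (tab p t) t
      else if t < p t then rskInsert (tab p t) (p t) else tab p t := by
  have h : tab p (t + 1) = tableauSeq p (2 * t + 1 + 1) := rfl
  rw [h, tableauSeq, if_neg (by omega), show (2 * t + 1) / 2 = t by omega, tableauSeq_odd]
  split_ifs <;> first | rfl | omega

theorem tab_congr {p q : ℕ → ℕ} {t : ℕ} (h : ∀ a < t, p a = q a) : tab p t = tab q t := by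
  induction t with
  | zero => rfl
  | succ t ih => rw [tab_succ, tab_succ, ih fun a ha => h a (by omega), h t (by omega)]

/-- On the dots smaller than `n`, the function `p` describes arcs between these dots, isolated
dots, and arcs whose distinct right endpoints are at least `n`. -/
def IsPartialMatching (n : ℕ) (p : ℕ → ℕ) : Prop :=
  (∀ a < n, p a < n → p (p a) = a) ∧ ∀ a < n, ∀ b < n, p a = p b → a = b

theorem IsPartialMatching.of_le {n m : ℕ} {p : ℕ → ℕ} (h : IsPartialMatching n p) (hm : m ≤ n) :
    IsPartialMatching m p :=
  ⟨fun a ha hp => h.1 a (by omega) (by omega), fun a ha b hb => h.2 a (by omega) b (by omega)⟩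

/-- The left endpoints smaller than `t` of arcs with right endpoints at least `t`. -/
def alive (p : ℕ → ℕ) (t : ℕ) : Finset ℕ := (Finset.range t).filter fun a => t ≤ p a

theorem mem_alive {p : ℕ → ℕ} {t a : ℕ} : a ∈ alive p t ↔ a < t ∧ t ≤ p a := by simp [alive]

/-- The word of the right endpoints of the arcs over the gap before the dot `t`. -/
def word (p : ℕ → ℕ) (t : ℕ) : List ℕ := ((List.range t).filter fun a => t ≤ p a).map p

theorem mem_word {p : ℕ → ℕ} {t x : ℕ} : x ∈ word p t ↔ ∃ a ∈ alive p t, p a = x := by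
  simp [word, alive]

theorem word_succ (p : ℕ → ℕ) (t : ℕ) :
    word p (t + 1) = (word p t).filter (t < ·) ++ if t < p t then [p t] else [] := by
  rw [word, word, List.range_succ, List.filter_append, List.map_append, List.filter_map,
    List.filter_filter]
  congr 1
  · congr 1
    apply List.filter_congr
    intro a _
    simp
    omega
  · by_cases h : t < p t <;> simp [h]

theorem IsPartialMatching.nodup_word {n : ℕ} {p : ℕ → ℕ} (hp : IsPartialMatching n p) {t : ℕ}
    (ht : t ≤ n) : (word p t).Nodup := by
  rw [word, List.nodup_map_iff_inj_on (List.nodup_range.filter _)]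
  intro a ha b hb h
  simp only [List.mem_filter, List.mem_range] at ha hb
  exact hp.2 a (by omega) b (by omega) h

theorem Knuth.perm {w w' : List ℕ} (h : Knuth w w') : w.Perm w' := by
  induction h with
  | rel _ _ h =>
    cases h with
    | left u v _ _ => exact ((List.Perm.swap _ _ _).cons _ |>.append_left u).append_right v
    | right u v _ _ => exact ((List.Perm.swap _ _ _).append_left u).append_right v
  | refl _ => exact List.Perm.refl _
  | symm _ _ _ ih => exact ih.symm
  | trans _ _ _ _ _ ih ih' => exact ih.trans ih'

/-- The tableau `T` is the insertion tableau of the word `w`, up to Knuth equivalence. -/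
def Represents (T : Tableau) (w : List ℕ) : Prop := IsTableau T ∧ Knuth (reading T) w

theorem Represents.perm {T : Tableau} {w : List ℕ} (h : Represents T w) : T.flatten.Perm w :=
  (reading_perm T).symm.trans h.2.perm

/-- At time `t` all letters are at least `t`. Deleting `t`, or doing nothing when `t` is absent,
therefore amounts to keeping the letters larger than `t`, an operation compatible with Knuth
equivalence. -/
theorem IsPartialMatching.represents {n : ℕ} {p : ℕ → ℕ} (hp : IsPartialMatching n p) {t : ℕ}
    (ht : t ≤ n) : Represents (tab p t) (word p t) := by
  induction t with
  | zero => exact ⟨trivial, Knuth.refl _⟩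
  | succ t ih =>
    have h := ih (by omega)
    have hperm := h.perm
    have hn : (tab p t).flatten.Nodup := hperm.symm.nodup (hp.nodup_word (by omega))
    have hge : ∀ x ∈ (tab p t).flatten, t ≤ x := by
      intro x hx
      obtain ⟨a, ha, rfl⟩ := mem_word.1 (hperm.subset hx)
      exact (mem_alive.1 ha).2
    have hmem : t ∈ (tab p t).flatten ↔ p t < t := by
      rw [hperm.mem_iff, mem_word]
      constructor
      · rintro ⟨a, ha, rfl⟩
        have := mem_alive.1 ha
        rw [hp.1 a (by omega) (by omega)]
        exact this.1
      · intro hlt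
        have := hp.1 t (by omega) (by omega)
        exact ⟨p t, mem_alive.2 ⟨hlt, by omega⟩, this⟩
    have hfil : (reading (tab p t)).filter (fun y => y ≠ t) =
        (reading (tab p t)).filter (t < ·) := by
      apply List.filter_congr
      intro x hx
      have := hge x ((reading_perm _).subset hx)
      rw [decide_eq_decide]
      omega
    rw [word_succ, tab_succ]
    rcases lt_trichotomy (p t) t with h1 | h1 | h1
    · rw [if_pos h1, if_neg (by omega)]
      refine ⟨(tabDelete_min h.1 hn (hmem.2 h1) hge).1, ?_⟩
      rw [reading_tabDelete, hfil, List.append_nil]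
      exact h.2.filter t
    · rw [if_neg (by omega), if_neg (by omega), if_neg (by omega)]
      refine ⟨h.1, ?_⟩
      rw [List.append_nil, ← filter_ne_eq_self (l := reading (tab p t)) (i := t)
        fun hx => by have := hmem.1 ((reading_perm _).subset hx); omega, hfil]
      exact h.2.filter t
    · rw [if_pos h1, if_neg (by omega), if_pos h1]
      have hnot : p t ∉ (tab p t).flatten := fun hx => by
        obtain ⟨a, ha, e⟩ := mem_word.1 (hperm.subset hx)
        have := mem_alive.1 ha
        have := hp.2 a (by omega) t (by omega) e
        omega
      refine ⟨h.1.rskInsert hn hnot, ?_⟩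
      refine (knuth_rskInsert h.1 hn hnot).symm.trans (Knuth.append_right ?_ _)
      rw [← filter_ne_eq_self (l := reading (tab p t)) (i := t)
        fun hx => by have := hmem.1 ((reading_perm _).subset hx); omega, hfil]
      exact h.2.filter t

theorem mem_flatten_tab {n : ℕ} {p : ℕ → ℕ} (hp : IsPartialMatching n p) {t : ℕ} (ht : t ≤ n)
    {x : ℕ} : x ∈ (tab p t).flatten ↔ ∃ a ∈ alive p t, p a = x := by
  rw [(hp.represents ht).perm.mem_iff, mem_word]

theorem le_of_mem_flatten_tab {n : ℕ} {p : ℕ → ℕ} (hp : IsPartialMatching n p) {t : ℕ}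
    (ht : t ≤ n) {x : ℕ} (hx : x ∈ (tab p t).flatten) : t ≤ x := by
  obtain ⟨a, ha, rfl⟩ := (mem_flatten_tab hp ht).1 hx
  exact (mem_alive.1 ha).2

theorem nodup_flatten_tab {n : ℕ} {p : ℕ → ℕ} (hp : IsPartialMatching n p) {t : ℕ}
    (ht : t ≤ n) : (tab p t).flatten.Nodup :=
  (hp.represents ht).perm.symm.nodup (hp.nodup_word ht)

theorem mem_flatten_tab_self {n : ℕ} {p : ℕ → ℕ} (hp : IsPartialMatching n p) {t : ℕ}
    (ht : t < n) (h : p t < t) : t ∈ (tab p t).flatten := by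
  have := hp.1 t ht (by omega)
  exact (mem_flatten_tab hp ht.le).2 ⟨p t, mem_alive.2 ⟨h, by omega⟩, this⟩

theorem card_shape_tab {n : ℕ} {p : ℕ → ℕ} (hp : IsPartialMatching n p) {t : ℕ} (ht : t ≤ n) :
    (shape (tab p t)).card = (alive p t).card := by
  rw [card_shape, (hp.represents ht).perm.length_eq, word, List.length_map, alive, Finset.card_def]
  simp [Finset.filter, Finset.range, Multiset.range]

/-! ### The steps of the sequence of shapes -/

/-- A closer removes a cell. -/
theorem shape_tab_succ_of_lt {n : ℕ} {p : ℕ → ℕ} (hp : IsPartialMatching n p) {t : ℕ}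
    (ht : t < n) (h : p t < t) : ∃ c, c ∉ shape (tab p (t + 1)) ∧
      shape (tab p t) = insert c (shape (tab p (t + 1))) := by
  rw [tab_succ, if_pos h]
  exact shape_tabDelete (hp.represents ht.le).1 (nodup_flatten_tab hp ht.le)
    (mem_flatten_tab_self hp ht h) fun y hy => le_of_mem_flatten_tab hp ht.le hy

/-- An opener adds a cell. -/
theorem shape_tab_succ_of_gt {p : ℕ → ℕ} {t : ℕ}
    (h : t < p t) : ∃ c, c ∉ shape (tab p t) ∧
      shape (tab p (t + 1)) = insert c (shape (tab p t)) := by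
  rw [tab_succ, if_neg (by omega), if_pos h]
  exact shape_rskInsert _ _

theorem tab_succ_of_eq {p : ℕ → ℕ} {t : ℕ} (h : p t = t) : tab p (t + 1) = tab p t := by
  rw [tab_succ, if_neg (by omega), if_neg (by omega)]

/-- The sizes of consecutive shapes reveal whether a dot is a closer, an opener or isolated.
Transposition keeps these sizes. -/
theorem card_shape_tab_lt_iff {n : ℕ} {p : ℕ → ℕ} (hp : IsPartialMatching n p) {t : ℕ}
    (ht : t < n) :
    ((shape (tab p (t + 1))).card < (shape (tab p t)).card ↔ p t < t) ∧
    ((shape (tab p t)).card < (shape (tab p (t + 1))).card ↔ t < p t) := by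
  rcases lt_trichotomy (p t) t with h | h | h
  · obtain ⟨c, hc, e⟩ := shape_tab_succ_of_lt hp ht h
    rw [e, Finset.card_insert_of_notMem hc]
    omega
  · rw [tab_succ_of_eq h]
    omega
  · obtain ⟨c, hc, e⟩ := shape_tab_succ_of_gt h
    rw [e, Finset.card_insert_of_notMem hc]
    omega

/-- A dot causes a deletion or an insertion but never both, so the half-step has the smaller of the
two neighbouring shapes. The terms of odd rank thus carry no information. -/
theorem shape_tableauSeq_odd {n : ℕ} {p : ℕ → ℕ} (hp : IsPartialMatching n p) {t : ℕ}
    (ht : t < n) : shape (tableauSeq p (2 * t + 1)) = shape (tab p t) ∩ shape (tab p (t + 1)) := by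
  rw [tableauSeq_odd]
  rcases lt_trichotomy (p t) t with h | h | h
  · obtain ⟨c, hc, e⟩ := shape_tab_succ_of_lt hp ht h
    have h2 : tab p (t + 1) = tabDelete (tab p t) t := by rw [tab_succ, if_pos h]
    rw [if_pos h, ← h2, e, Finset.inter_eq_right.2 (Finset.subset_insert _ _)]
  · rw [tab_succ_of_eq h, if_neg (by omega), Finset.inter_self]
  · obtain ⟨c, hc, e⟩ := shape_tab_succ_of_gt h
    rw [if_neg (by omega), e, Finset.inter_eq_left.2 (Finset.subset_insert _ _)]

/-! ### Nestings and crossings -/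

theorem hasChain_word_iff {r : ℕ → ℕ → Prop} {p : ℕ → ℕ} {t k : ℕ} :
    HasChain r k (word p t) ↔ ∃ S ⊆ alive p t, S.card = k ∧
      ∀ a ∈ S, ∀ b ∈ S, a < b → r (p a) (p b) := by
  have hlt : ((List.range t).filter fun a => decide (t ≤ p a)).Pairwise (· < ·) :=
    List.pairwise_lt_range.filter _
  constructor
  · rintro ⟨l, h1, h2, h3⟩
    obtain ⟨m, hm, rfl⟩ := List.sublist_map_iff.1 h1
    rw [List.pairwise_map] at h2
    have hmlt := hlt.sublist hm
    refine ⟨m.toFinset, ?_, ?_, ?_⟩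
    · intro a ha
      have := hm.subset (List.mem_toFinset.1 ha)
      simpa [alive] using this
    · rw [List.toFinset_card_of_nodup (hmlt.imp fun h => h.ne), ← h3, List.length_map]
    · simp only [List.mem_toFinset]
      clear hm h1 h3
      induction m with
      | nil => simp
      | cons x m ih =>
        rw [List.pairwise_cons] at h2 hmlt
        intro a ha b hb hab
        rcases List.mem_cons.1 ha with rfl | ha' <;> rcases List.mem_cons.1 hb with rfl | hb'
        · omega
        · exact h2.1 b hb'
        · have := hmlt.1 a ha'
          omega
        · exact ih h2.2 hmlt.2 a ha' b hb' hab
  · rintro ⟨S, h1, h2, h3⟩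
    have hs : ((List.range t).filter fun a => decide (a ∈ S)).Sublist
        ((List.range t).filter fun a => decide (t ≤ p a)) := by
      have : (List.range t).filter (fun a => decide (a ∈ S)) =
          ((List.range t).filter fun a => decide (t ≤ p a)).filter fun a => decide (a ∈ S) := by
        rw [List.filter_filter]
        apply List.filter_congr
        intro a _
        by_cases ha : a ∈ S
        · simp [ha, (mem_alive.1 (h1 ha)).2]
        · simp [ha]
      rw [this]
      exact List.filter_sublist
    refine ⟨((List.range t).filter fun a => decide (a ∈ S)).map p, hs.map p, ?_, ?_⟩
    · rw [List.pairwise_map]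
      refine (hlt.sublist hs).imp_of_mem fun {a b} ha hb hab => ?_
      simp only [List.mem_filter, decide_eq_true_eq] at ha hb
      exact h3 a ha.2 b hb.2 hab
    · rw [List.length_map, ← h2]
      have : S = ((List.range t).filter fun a => decide (a ∈ S)).toFinset := by
        ext a
        simp only [List.mem_toFinset, List.mem_filter, List.mem_range, decide_eq_true_eq]
        exact ⟨fun h => ⟨(mem_alive.1 (h1 h)).1, h⟩, fun h => h.2⟩
      conv_rhs => rw [this]
      rw [List.toFinset_card_of_nodup (List.nodup_range.filter _)]

/-- The width of the shapes is governed by nestings. -/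
theorem zero_mem_shape_tab {n : ℕ} {p : ℕ → ℕ} (hp : IsPartialMatching n p) {t : ℕ} (ht : t ≤ n)
    {k : ℕ} : (0, k) ∈ shape (tab p t) ↔ ∃ S ⊆ alive p t, S.card = k + 1 ∧
      ∀ a ∈ S, ∀ b ∈ S, a < b → p b < p a := by
  have h := hp.represents ht
  rw [← hasChain_word_iff (r := (· > ·)), ← h.2.hasChain_gt_iff, hasChain_gt_reading h.1,
    mem_shape, headD_length_eq]
  rfl

theorem IsTableau.mem_shape_zero {T : Tableau} (hT : IsTableau T) {k : ℕ} :
    (k, 0) ∈ shape T ↔ k < T.length := by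
  induction T generalizing k with
  | nil => simp
  | cons R Rs ih =>
    cases k with
    | zero => simpa using List.length_pos_iff.2 hT.1
    | succ k => simpa using ih hT.2.2.2

/-- The height of the shapes is governed by crossings. -/
theorem mem_shape_tab_zero {n : ℕ} {p : ℕ → ℕ} (hp : IsPartialMatching n p) {t : ℕ} (ht : t ≤ n)
    {k : ℕ} : (k, 0) ∈ shape (tab p t) ↔ ∃ S ⊆ alive p t, S.card = k + 1 ∧
      ∀ a ∈ S, ∀ b ∈ S, a < b → p a < p b := by
  have h := hp.represents ht
  rw [← hasChain_word_iff (r := (· < ·)), ← h.2.hasChain_lt_iff, hasChain_lt_reading h.1,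
    h.1.mem_shape_zero]
  rfl

/-! ### Reconstruction from the sequence of shapes -/

/-- A partial matching is determined by its sequence of shapes and its last tableau. -/
theorem partialMatching_unique {n : ℕ} {p q : ℕ → ℕ} (hp : IsPartialMatching n p)
    (hq : IsPartialMatching n q) (hs : ∀ t ≤ n, shape (tab p t) = shape (tab q t))
    (hF : tab p n = tab q n) : ∀ a < n, p a = q a := by
  induction n with
  | zero => simp
  | succ n ih =>
    have hp' := hp.of_le (Nat.le_succ n)
    have hq' := hq.of_le (Nat.le_succ n)
    have hn := hs n (by omega)
    have c1 := card_shape_tab_lt_iff hp (Nat.lt_succ_self n)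
    have c2 := card_shape_tab_lt_iff hq (Nat.lt_succ_self n)
    rw [hn, hs (n + 1) le_rfl] at c1
    have e1 := c1.1.symm.trans c2.1
    have e2 := c1.2.symm.trans c2.2
    -- It is enough to undo the last step. If the dot `n` is a closer, its partner is then found
    -- among the earlier values, because the arc is already recorded at its left endpoint.
    suffices h : tab p n = tab q n ∧ (¬ p n < n → p n = q n) by
      have ih' := ih hp' hq' (fun t ht => hs t (by omega)) h.1
      intro a ha
      rcases Nat.lt_succ_iff_lt_or_eq.1 ha with ha' | rfl
      · exact ih' a ha'
      · by_cases hlt : p a < a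
        · have h1 := hp.1 a ha (by omega)
          have h2 := ih' _ hlt
          have h3 := hq.1 (p a) (by omega) (by omega)
          rw [← h2, h1] at h3
          exact h3.symm
        · exact h.2 hlt
    rw [tab_succ, tab_succ] at hF
    by_cases hlt : p n < n
    · rw [if_pos hlt, if_pos (e1.1 hlt)] at hF
      refine ⟨?_, fun h => absurd hlt h⟩
      exact tabDelete_inj (hp'.represents le_rfl).1 (hq'.represents le_rfl).1
        (nodup_flatten_tab hp' le_rfl) (nodup_flatten_tab hq' le_rfl)
        (mem_flatten_tab_self hp (Nat.lt_succ_self n) hlt)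
        (mem_flatten_tab_self hq (Nat.lt_succ_self n) (e1.1 hlt))
        (fun _ => le_of_mem_flatten_tab hp' le_rfl) (fun _ => le_of_mem_flatten_tab hq' le_rfl)
        hn hF
    · rw [if_neg hlt, if_neg (e1.not.1 hlt)] at hF
      by_cases hgt : n < p n
      · rw [if_pos hgt, if_pos (e2.1 hgt)] at hF
        have := rskInsert_inj (hp'.represents le_rfl).1 (hq'.represents le_rfl).1 hn hF
        exact ⟨this.2, fun _ => this.1⟩
      · rw [if_neg hgt, if_neg (e2.not.1 hgt)] at hF
        refine ⟨hF, fun _ => ?_⟩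
        have := e1.not.1 hlt
        have := e2.not.1 hgt
        omega

/-- Sequences of diagrams starting from the empty diagram where each step is trivial, or adds or
removes a cell. -/
def IsDiagramWalk (n : ℕ) (u : ℕ → Finset (ℕ × ℕ)) : Prop :=
  (∀ t ≤ n, IsLowerSet (u t : Set (ℕ × ℕ))) ∧ u 0 = ∅ ∧
    ∀ t < n, u (t + 1) = u t ∨ (∃ c, c ∉ u t ∧ u (t + 1) = insert c (u t)) ∨
      ∃ c, c ∉ u (t + 1) ∧ u t = insert c (u (t + 1))

theorem IsPartialMatching.isDiagramWalk {n : ℕ} {p : ℕ → ℕ} (hp : IsPartialMatching n p) :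
    IsDiagramWalk n fun t => shape (tab p t) := by
  refine ⟨fun t ht => (hp.represents ht).1.isLowerSet, rfl, fun t ht => ?_⟩
  rcases lt_trichotomy (p t) t with h | h | h
  · exact Or.inr (Or.inr (shape_tab_succ_of_lt hp ht h))
  · exact Or.inl (by simp only [tab_succ_of_eq h])
  · exact Or.inr (Or.inl (shape_tab_succ_of_gt h))

/-- Every walk on diagrams is the sequence of shapes of a partial matching with a given last
tableau. -/
theorem exists_partialMatching {n : ℕ} {u : ℕ → Finset (ℕ × ℕ)} (hu : IsDiagramWalk n u)
    {F : Tableau} (hF : IsTableau F) (hn : F.flatten.Nodup) (hge : ∀ x ∈ F.flatten, n ≤ x)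
    (hs : shape F = u n) :
    ∃ p, IsPartialMatching n p ∧ (∀ t ≤ n, shape (tab p t) = u t) ∧ tab p n = F := by
  induction n generalizing F with
  | zero =>
    have hnil : F = [] := by
      cases F with
      | nil => rfl
      | cons R Rs => exact absurd (hs.trans hu.2.1) (shape_cons_ne_nil hF.1)
    refine ⟨id, ⟨by simp, by simp⟩, fun t ht => ?_, by rw [hnil]; rfl⟩
    obtain rfl : t = 0 := by omega
    exact hu.2.1.symm
  | succ n ih =>
    have hu' : IsDiagramWalk n u :=
      ⟨fun t ht => hu.1 t (by omega), hu.2.1, fun t ht => hu.2.2 t (by omega)⟩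
    have finish : ∀ (p : ℕ → ℕ) (y : ℕ), (∀ t ≤ n, shape (tab p t) = u t) →
        tab (Function.update p n y) (n + 1) = F → ∀ t ≤ n + 1,
        shape (tab (Function.update p n y) t) = u t := by
      intro p y h1 h2 t ht
      rcases Nat.le_succ_iff.1 ht with ht | rfl
      · rw [tab_congr (q := p), h1 t ht]
        intro a ha
        rw [Function.update_of_ne (by omega)]
      · rw [h2, hs]
    have hcongr : ∀ (p : ℕ → ℕ) (y : ℕ), tab (Function.update p n y) n = tab p n := fun p y =>
      tab_congr fun a ha => by rw [Function.update_of_ne (by omega)]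
    rcases hu.2.2 n (by omega) with h | ⟨c, hc, h⟩ | ⟨c, hc, h⟩
    -- Trivial step: `n` is made isolated. No earlier arc ends at `n`, as the entries of `F` are at
    -- least `n + 1`.
    · obtain ⟨p, h1, h2, h3⟩ := ih hu' hF hn (fun x hx => (Nat.le_succ n).trans (hge x hx))
        (hs.trans h)
      have hne : ∀ a < n, p a ≠ n := fun a ha e => by
        have := hge n (h3 ▸ (mem_flatten_tab h1 le_rfl).2 ⟨a, mem_alive.2 ⟨ha, e.ge⟩, e⟩)
        omega
      have hlast : tab (Function.update p n n) (n + 1) = F := by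
        rw [tab_succ_of_eq (by simp), hcongr, h3]
      refine ⟨Function.update p n n, ⟨fun a ha hlt => ?_, fun a ha b hb e => ?_⟩,
        finish p n h2 hlast, hlast⟩
      · rcases Nat.lt_succ_iff_lt_or_eq.1 ha with ha | rfl
        · rw [Function.update_of_ne (by omega : a ≠ n)] at hlt ⊢
          have := hne a ha
          rw [Function.update_of_ne (by omega), h1.1 a ha (by omega)]
        · simp
      · rcases Nat.lt_succ_iff_lt_or_eq.1 ha with ha | rfl <;>
          rcases Nat.lt_succ_iff_lt_or_eq.1 hb with hb | rfl
        · rw [Function.update_of_ne (by omega), Function.update_of_ne (by omega)] at e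
          exact h1.2 a ha b hb e
        · rw [Function.update_of_ne (by omega), Function.update_self] at e
          exact absurd e (hne a ha)
        · rw [Function.update_of_ne (by omega : b ≠ a), Function.update_self] at e
          exact absurd e.symm (hne b hb)
        · rfl
    -- A cell is added: `n` is an opener, and its partner is the entry `x` expelled by reverse
    -- insertion.
    · obtain ⟨F', x, t1, t2, t3⟩ := exists_rskInsert_eq hF hn (hu.1 n (by omega)) hc (hs.trans h)
      have hperm := rskInsert_perm F' x
      rw [t2] at hperm
      have hn' := hperm.nodup hn
      rw [List.nodup_cons] at hn'
      have hx : n + 1 ≤ x := hge x (hperm.symm.subset (by simp))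
      have hge' : ∀ y ∈ F'.flatten, n + 1 ≤ y := fun y hy => hge y (hperm.symm.subset (by simp [hy]))
      obtain ⟨p, h1, h2, h3⟩ := ih hu' t1 hn'.2 (fun y hy => (Nat.le_succ n).trans (hge' y hy)) t3
      have hmem : ∀ a < n, n ≤ p a → p a ∈ F'.flatten := fun a ha hle =>
        h3 ▸ (mem_flatten_tab h1 le_rfl).2 ⟨a, mem_alive.2 ⟨ha, hle⟩, rfl⟩
      have hne : ∀ a < n, p a ≠ x := fun a ha e => hn'.1 (e ▸ hmem a ha (by omega))
      have hlast : tab (Function.update p n x) (n + 1) = F := by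
        rw [tab_succ, Function.update_self, if_neg (by omega), if_pos (by omega), hcongr, h3, t2]
      refine ⟨Function.update p n x, ⟨fun a ha hlt => ?_, fun a ha b hb e => ?_⟩,
        finish p x h2 hlast, hlast⟩
      · rcases Nat.lt_succ_iff_lt_or_eq.1 ha with ha | rfl
        · rw [Function.update_of_ne (by omega : a ≠ n)] at hlt ⊢
          have : p a < n := by
            by_contra hcon
            have := hge' _ (hmem a ha (by omega))
            omega
          rw [Function.update_of_ne (by omega), h1.1 a ha (by omega)]
        · rw [Function.update_self] at hlt
          omega
      · rcases Nat.lt_succ_iff_lt_or_eq.1 ha with ha | rfl <;>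
          rcases Nat.lt_succ_iff_lt_or_eq.1 hb with hb | rfl
        · rw [Function.update_of_ne (by omega), Function.update_of_ne (by omega)] at e
          exact h1.2 a ha b hb e
        · rw [Function.update_of_ne (by omega), Function.update_self] at e
          exact absurd e (hne a ha)
        · rw [Function.update_of_ne (by omega : b ≠ a), Function.update_self] at e
          exact absurd e.symm (hne b hb)
        · rfl
    -- A cell is removed: `n` is a closer. The entry `n` is put back in the tableau, and the
    -- induction hypothesis supplies the left endpoint `x` of the arc ending there.
    · rw [← hs] at hc h
      obtain ⟨F', t1, t2, t3, hperm⟩ := exists_tabDelete_eq hF (i := n) (fun y hy => hge y hy)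
        (hu.1 n (by omega)) hc h
      have hnF : n ∉ F.flatten := fun hx => by
        have := hge n hx
        omega
      have hn' : F'.flatten.Nodup := hperm.symm.nodup (List.nodup_cons.2 ⟨hnF, hn⟩)
      obtain ⟨p, h1, h2, h3⟩ := ih hu' t1 hn' (fun y hy => by
        rcases List.mem_cons.1 (hperm.subset hy) with rfl | hy
        · exact le_rfl
        · exact (Nat.le_succ n).trans (hge y hy)) t3
      have hnm : n ∈ (tab p n).flatten := by
        rw [h3]
        exact hperm.symm.subset (by simp)
      obtain ⟨x, hx, hxn⟩ := (mem_flatten_tab h1 le_rfl).1 hnm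
      have hx := (mem_alive.1 hx).1
      have hne : ∀ a < n, p a ≠ x := fun a ha e => by
        have := h1.1 a ha (by omega)
        rw [e, hxn] at this
        omega
      have hlast : tab (Function.update p n x) (n + 1) = F := by
        rw [tab_succ, Function.update_self, if_pos (by omega), hcongr, h3, t2]
      refine ⟨Function.update p n x, ⟨fun a ha hlt => ?_, fun a ha b hb e => ?_⟩,
        finish p x h2 hlast, hlast⟩
      · rcases Nat.lt_succ_iff_lt_or_eq.1 ha with ha | rfl
        · rw [Function.update_of_ne (by omega : a ≠ n)] at hlt ⊢
          rcases Nat.lt_succ_iff_lt_or_eq.1 hlt with hlt | hlt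
          · rw [Function.update_of_ne (by omega), h1.1 a ha hlt]
          · rw [hlt, Function.update_self]
            exact h1.2 x hx a ha (hxn.trans hlt.symm)
        · rw [Function.update_self, Function.update_of_ne (by omega), hxn]
      · rcases Nat.lt_succ_iff_lt_or_eq.1 ha with ha | rfl <;>
          rcases Nat.lt_succ_iff_lt_or_eq.1 hb with hb | rfl
        · rw [Function.update_of_ne (by omega), Function.update_of_ne (by omega)] at e
          exact h1.2 a ha b hb e
        · rw [Function.update_of_ne (by omega), Function.update_self] at e
          exact absurd e (hne a ha)
        · rw [Function.update_of_ne (by omega : b ≠ a), Function.update_self] at e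
          exact absurd e.symm (hne b hb)
        · rfl

/-! ### Closures of open matchings -/

variable {n : ℕ}

theorem partner_of_lt (α : Invol n) {a : ℕ} (h : a < n) : partner α a = α.1 ⟨a, h⟩ := dif_pos h

theorem partner_val (α : Invol n) (i : Fin n) : partner α i = α.1 i := partner_of_lt α i.2

theorem partner_lt (α : Invol n) {a : ℕ} (h : a < n) : partner α a < n := by
  rw [partner_of_lt α h]
  exact Fin.is_lt _

theorem partner_partner (α : Invol n) {a : ℕ} (h : a < n) : partner α (partner α a) = a := by
  rw [partner_of_lt α h, partner_val, α.2]

theorem isPartialMatching_partner (α : Invol n) : IsPartialMatching n (partner α) := by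
  refine ⟨fun a ha _ => partner_partner α ha, fun a ha b hb h => ?_⟩
  rw [← partner_partner α ha, h, partner_partner α hb]

theorem invol_ext {α β : Invol n} (h : ∀ a < n, partner α a = partner β a) : α = β := by
  apply Subtype.ext
  ext i
  rw [← partner_val, ← partner_val, h i i.2]

/-- The involution given by an involutive map on natural numbers. -/
def involOf (p : ℕ → ℕ) (h : ∀ a < n, p a < n ∧ p (p a) = a) : Invol n :=
  ⟨Function.Involutive.toPerm (fun i : Fin n => ⟨p i, (h i i.2).1⟩)
    fun i => Fin.ext (h i i.2).2, fun i => Fin.ext (h i i.2).2⟩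

theorem partner_involOf {p : ℕ → ℕ} (h : ∀ a < n, p a < n ∧ p (p a) = a) {a : ℕ} (ha : a < n) :
    partner (involOf p h) a = p a := by
  rw [partner_of_lt _ ha]
  rfl

/-- The set of fixed points. -/
def fixedSet (α : Invol n) : Finset ℕ := (Finset.range n).filter fun a => partner α a = a

theorem mem_fixedSet {α : Invol n} {a : ℕ} : a ∈ fixedSet α ↔ a < n ∧ partner α a = a := by
  simp [fixedSet]

theorem fixedSet_eq_map (α : Invol n) :
    fixedSet α = (Finset.univ.filter fun i => α.1 i = i).map Fin.valEmbedding := by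
  ext a
  simp only [mem_fixedSet, Finset.mem_map, Finset.mem_filter, Finset.mem_univ, true_and,
    Fin.valEmbedding_apply]
  constructor
  · rintro ⟨h, e⟩
    rw [partner_of_lt α h] at e
    exact ⟨⟨a, h⟩, Fin.ext e, rfl⟩
  · rintro ⟨i, hi, rfl⟩
    exact ⟨i.2, by rw [partner_val, hi]⟩

theorem card_fixedSet (α : Invol n) : (fixedSet α).card = numFixed α := by
  rw [fixedSet_eq_map, Finset.card_map, numFixed]

theorem fixedBefore_eq (α : Invol n) (a : ℕ) :
    fixedBefore α a = ((fixedSet α).filter (· < a)).card := by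
  rw [fixedSet_eq_map, Finset.filter_map, Finset.card_map, fixedBefore, Finset.filter_filter]
  congr 1
  ext i
  simp [and_comm]

theorem fixedBefore_lt {α : Invol n} {a : ℕ} (ha : a ∈ fixedSet α) :
    fixedBefore α a < numFixed α := by
  rw [fixedBefore_eq, ← card_fixedSet]
  apply Finset.card_lt_card
  rw [Finset.filter_ssubset]
  exact ⟨a, ha, lt_irrefl a⟩

theorem fixedBefore_lt_of_lt {α : Invol n} {a b : ℕ} (ha : a ∈ fixedSet α) (hab : a < b) :
    fixedBefore α a < fixedBefore α b := by
  rw [fixedBefore_eq, fixedBefore_eq]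
  apply Finset.card_lt_card
  rw [Finset.ssubset_iff_of_subset]
  · exact ⟨a, by simp [ha, hab], by simp⟩
  · intro c
    simp only [Finset.mem_filter]
    exact fun h => ⟨h.1, h.2.trans hab⟩

/-- The function `q` gives the partners in a closed matching obtained from an open matching by
joining the open arcs to new dots placed after the others. -/
structure IsClosure (α : Invol n) (q : ℕ → ℕ) : Prop where
  eq_partner : ∀ a < n, partner α a ≠ a → q a = partner α a
  le : ∀ a ∈ fixedSet α, n ≤ q a
  lt : ∀ a ∈ fixedSet α, q a < n + numFixed α
  inj : ∀ a ∈ fixedSet α, ∀ b ∈ fixedSet α, q a = q b → a = b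

theorem partnerNested_of_mem {α : Invol n} {a : ℕ} (ha : a ∈ fixedSet α) :
    partnerNested α a = n + numFixed α - 1 - fixedBefore α a :=
  if_pos (mem_fixedSet.1 ha).2

theorem partnerCrossed_of_mem {α : Invol n} {a : ℕ} (ha : a ∈ fixedSet α) :
    partnerCrossed α a = n + fixedBefore α a :=
  if_pos (mem_fixedSet.1 ha).2

theorem partnerNested_anti {α : Invol n} {a b : ℕ} (ha : a ∈ fixedSet α) (hb : b ∈ fixedSet α)
    (hab : a < b) : partnerNested α b < partnerNested α a := by
  rw [partnerNested_of_mem ha, partnerNested_of_mem hb]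
  have := fixedBefore_lt hb
  have := fixedBefore_lt_of_lt ha hab
  omega

theorem partnerCrossed_mono {α : Invol n} {a b : ℕ} (ha : a ∈ fixedSet α) (hb : b ∈ fixedSet α)
    (hab : a < b) : partnerCrossed α a < partnerCrossed α b := by
  rw [partnerCrossed_of_mem ha, partnerCrossed_of_mem hb]
  have := fixedBefore_lt_of_lt ha hab
  omega

theorem isClosure_partnerNested (α : Invol n) : IsClosure α (partnerNested α) where
  eq_partner a _ h := if_neg h
  le a ha := by
    rw [partnerNested_of_mem ha]
    have := fixedBefore_lt ha
    omega
  lt a ha := by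
    rw [partnerNested_of_mem ha]
    have := fixedBefore_lt ha
    omega
  inj a ha b hb h := by
    rcases lt_trichotomy a b with hlt | rfl | hlt
    · have := partnerNested_anti ha hb hlt
      omega
    · rfl
    · have := partnerNested_anti hb ha hlt
      omega

theorem isClosure_partnerCrossed (α : Invol n) : IsClosure α (partnerCrossed α) where
  eq_partner a _ h := if_neg h
  le a ha := by
    rw [partnerCrossed_of_mem ha]
    omega
  lt a ha := by
    rw [partnerCrossed_of_mem ha]
    have := fixedBefore_lt ha
    omega
  inj a ha b hb h := by
    rcases lt_trichotomy a b with hlt | rfl | hlt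
    · have := partnerCrossed_mono ha hb hlt
      omega
    · rfl
    · have := partnerCrossed_mono hb ha hlt
      omega

/-! ### Properties shared by the two closures -/

namespace IsClosure

variable {α : Invol n} {q : ℕ → ℕ}

theorem lt_iff (h : IsClosure α q) {a : ℕ} (ha : a < n) : q a < n ↔ partner α a ≠ a := by
  constructor
  · intro hlt e
    have := h.le a (mem_fixedSet.2 ⟨ha, e⟩)
    omega
  · intro e
    rw [h.eq_partner a ha e]
    exact partner_lt α ha

theorem isPartialMatching (h : IsClosure α q) : IsPartialMatching n q := by
  refine ⟨fun a ha hlt => ?_, fun a ha b hb e => ?_⟩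
  · have hne := (h.lt_iff ha).1 hlt
    rw [h.eq_partner a ha hne, h.eq_partner _ (partner_lt α ha), partner_partner α ha]
    rw [partner_partner α ha]
    exact hne.symm
  · by_cases hlt : q a < n
    · have h1 := (h.lt_iff ha).1 hlt
      have h2 := (h.lt_iff hb).1 (e ▸ hlt)
      rw [h.eq_partner a ha h1, h.eq_partner b hb h2] at e
      exact (isPartialMatching_partner α).2 a ha b hb e
    · have h1 := (h.lt_iff ha).not.1 hlt
      have h2 := (h.lt_iff hb).not.1 (e ▸ hlt)
      push Not at h1 h2
      exact h.inj a (mem_fixedSet.2 ⟨ha, h1⟩) b (mem_fixedSet.2 ⟨hb, h2⟩) e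

theorem ne_self (h : IsClosure α q) {a : ℕ} (ha : a < n) : q a ≠ a := by
  intro e
  have h1 := (h.lt_iff ha).1 (by omega)
  rw [← h.eq_partner a ha h1] at h1
  exact h1 e

theorem lt_self_iff (h : IsClosure α q) {a : ℕ} (ha : a < n) : q a < a ↔ partner α a < a := by
  by_cases e : partner α a = a
  · have := h.le a (mem_fixedSet.2 ⟨ha, e⟩)
    omega
  · rw [h.eq_partner a ha e]

theorem alive_eq (h : IsClosure α q) : alive q n = fixedSet α := by
  ext a
  rw [mem_alive, mem_fixedSet]
  refine and_congr_right fun ha => ?_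
  have := h.lt_iff ha
  rw [← not_lt, this, not_not]

theorem card_shape (h : IsClosure α q) : (shape (tab q n)).card = numFixed α := by
  rw [card_shape_tab h.isPartialMatching le_rfl, h.alive_eq, card_fixedSet]

/-- The entries are distinct new dots, and there are as many of them as new dots. -/
theorem toFinset_flatten (h : IsClosure α q) :
    (tab q n).flatten.toFinset = Finset.Ico n (n + numFixed α) := by
  have hm := fun x => mem_flatten_tab h.isPartialMatching le_rfl (x := x)
  simp only [h.alive_eq] at hm
  apply Finset.eq_of_subset_of_card_le
  · intro x hx
    obtain ⟨a, ha, rfl⟩ := (hm x).1 (List.mem_toFinset.1 hx)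
    exact Finset.mem_Ico.2 ⟨h.le a ha, h.lt a ha⟩
  · rw [List.toFinset_card_of_nodup (nodup_flatten_tab h.isPartialMatching le_rfl),
      ← InvolutionNesting.card_shape, h.card_shape]
    simp

end IsClosure

/-- The new arcs cross one another, so there are at least as many rows as open arcs; there are no
more cells than that. -/
theorem mem_shape_tab_partnerCrossed (α : Invol n) {x : ℕ × ℕ} :
    x ∈ shape (tab (partnerCrossed α) n) ↔ x.1 < numFixed α ∧ x.2 = 0 := by
  have h := isClosure_partnerCrossed α
  have hsub : (Finset.range (numFixed α)).image (fun k => (k, 0)) ⊆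
      shape (tab (partnerCrossed α) n) := by
    intro x hx
    obtain ⟨k, hk, rfl⟩ := Finset.mem_image.1 hx
    rw [Finset.mem_range, ← card_fixedSet] at hk
    obtain ⟨S, hS, hc⟩ := Finset.exists_subset_card_eq (Nat.succ_le_of_lt hk)
    rw [mem_shape_tab_zero h.isPartialMatching le_rfl, h.alive_eq]
    exact ⟨S, hS, hc, fun a ha b hb hab => partnerCrossed_mono (hS ha) (hS hb) hab⟩
  rw [← Finset.eq_of_subset_of_card_le hsub]
  · obtain ⟨a, b⟩ := x
    simp [eq_comm]
  · rw [h.card_shape, Finset.card_image_of_injective _ fun a b h => by simpa using h]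
    simp

theorem mem_shape_tab_partnerNested (α : Invol n) {x : ℕ × ℕ} :
    x ∈ shape (tab (partnerNested α) n) ↔ x.1 = 0 ∧ x.2 < numFixed α := by
  have h := isClosure_partnerNested α
  have hsub : (Finset.range (numFixed α)).image (fun k => (0, k)) ⊆
      shape (tab (partnerNested α) n) := by
    intro x hx
    obtain ⟨k, hk, rfl⟩ := Finset.mem_image.1 hx
    rw [Finset.mem_range, ← card_fixedSet] at hk
    obtain ⟨S, hS, hc⟩ := Finset.exists_subset_card_eq (Nat.succ_le_of_lt hk)
    rw [zero_mem_shape_tab h.isPartialMatching le_rfl, h.alive_eq]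
    exact ⟨S, hS, hc, fun a ha b hb hab => partnerNested_anti (hS ha) (hS hb) hab⟩
  rw [← Finset.eq_of_subset_of_card_le hsub]
  · obtain ⟨a, b⟩ := x
    simp [eq_comm, and_comm]
  · rw [h.card_shape, Finset.card_image_of_injective _ fun a b h => by simpa using h]
    simp

/-! ### Tableaux whose shape is a column or a row -/

theorem IsTableau.pairwise_flatten_of_column {F : Tableau} (hF : IsTableau F)
    (h : ∀ x ∈ shape F, x.2 = 0) : F.flatten.Pairwise (· > ·) := by
  induction F with
  | nil => simp
  | cons R Rs ih =>
    have ih := ih hF.2.2.2 fun x hx => h (x.1 + 1, x.2) (mem_shape_cons_succ.2 hx)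
    have hR : R.length ≤ 1 := by
      by_contra hlt
      have := h (0, 1) (mem_shape_cons_zero.2 (by omega))
      simp at this
    obtain ⟨a, rfl⟩ := List.length_eq_one_iff.1 (le_antisymm hR (List.length_pos_iff.2 hF.1))
    cases Rs with
    | nil => simp
    | cons S Ss =>
      obtain ⟨b, L, rfl⟩ := List.exists_cons_of_ne_nil hF.2.2.2.1
      have hba : b < a := hF.2.2.1.1
      simp only [List.flatten_cons, List.cons_append, List.nil_append] at ih ⊢
      refine List.pairwise_cons.2 ⟨fun x hx => ?_, ih⟩
      rcases List.mem_cons.1 hx with rfl | hx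
      · exact hba
      · exact (List.rel_of_pairwise_cons ih hx).trans hba

theorem IsTableau.pairwise_flatten_of_row {F : Tableau} (hF : IsTableau F)
    (h : ∀ x ∈ shape F, x.1 = 0) : F.flatten.Pairwise (· > ·) := by
  match F with
  | [] => simp
  | [R] => simpa using hF.2.1
  | R :: S :: Ss =>
    have := h (1, 0) (mem_shape_cons_succ.2 (mem_shape_cons_zero.2
      (List.length_pos_iff.2 hF.2.2.2.1)))
    simp at this

/-- For one-row or one-column shapes the set of entries leaves no choice. This is how the last
tableau of a closure is recovered from its shape. -/
theorem tableau_eq_of_pairwise_flatten {F G : Tableau} (hF : IsTableau F) (hG : IsTableau G)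
    (hs : shape F = shape G) (hF' : F.flatten.Pairwise (· > ·)) (hG' : G.flatten.Pairwise (· > ·))
    (h : F.flatten.toFinset = G.flatten.toFinset) : F = G := by
  have hp : F.flatten.Perm G.flatten :=
    List.perm_of_nodup_nodup_toFinset_eq (hF'.imp fun h => h.ne') (hG'.imp fun h => h.ne') h
  refine List.eq_iff_flatten_eq.2 ⟨hp.eq_of_pairwise ?_ hF' hG', hF.map_length_eq hG hs⟩
  intro a b _ _ h1 h2
  omega

/-- The column with entries `n + m - 1, …, n`. -/
def columnTableau (n : ℕ) : ℕ → Tableau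
  | 0 => []
  | m + 1 => [n + m] :: columnTableau n m

theorem isTableau_columnTableau (n m : ℕ) : IsTableau (columnTableau n m) := by
  induction m with
  | zero => trivial
  | succ m ih =>
    refine ⟨by simp, by simp, ?_, ih⟩
    cases m <;> simp [columnTableau]

theorem mem_shape_columnTableau (n m : ℕ) {x : ℕ × ℕ} :
    x ∈ shape (columnTableau n m) ↔ x.1 < m ∧ x.2 = 0 := by
  obtain ⟨r, c⟩ := x
  induction m generalizing r with
  | zero => simp [columnTableau]
  | succ m ih =>
    rw [columnTableau]
    cases r with
    | zero => simp
    | succ r => simpa using ih r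

theorem mem_flatten_columnTableau (n m : ℕ) {x : ℕ} :
    x ∈ (columnTableau n m).flatten ↔ n ≤ x ∧ x < n + m := by
  induction m with
  | zero => simp [columnTableau]
  | succ m ih =>
    simp only [columnTableau, List.flatten_cons, List.mem_append, List.mem_singleton, ih]
    omega

/-! ### Transposition -/

theorem mem_transpose {s : Finset (ℕ × ℕ)} {r c : ℕ} :
    (r, c) ∈ s.image Prod.swap ↔ (c, r) ∈ s := by
  simp only [Finset.mem_image, Prod.exists, Prod.swap_prod_mk, Prod.mk.injEq]
  constructor
  · rintro ⟨a, b, h, rfl, rfl⟩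
    exact h
  · exact fun h => ⟨c, r, h, rfl, rfl⟩

theorem card_transpose (s : Finset (ℕ × ℕ)) : (s.image Prod.swap).card = s.card :=
  Finset.card_image_of_injective _ Prod.swap_injective

theorem transpose_injective :
    Function.Injective fun s : Finset (ℕ × ℕ) => s.image Prod.swap :=
  Finset.image_injective Prod.swap_injective

theorem IsDiagramWalk.transpose {u : ℕ → Finset (ℕ × ℕ)} (h : IsDiagramWalk n u) :
    IsDiagramWalk n fun t => (u t).image Prod.swap := by
  have hins : ∀ (s s' : Finset (ℕ × ℕ)), (∃ c, c ∉ s ∧ s' = insert c s) →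
      ∃ c, c ∉ s.image Prod.swap ∧ s'.image Prod.swap = insert c (s.image Prod.swap) := by
    rintro s s' ⟨⟨a, b⟩, hc, rfl⟩
    exact ⟨(b, a), by rwa [mem_transpose], by rw [Finset.image_insert]; rfl⟩
  refine ⟨fun t ht => ?_, by simp [h.2.1], fun t ht => ?_⟩
  · rintro ⟨a, b⟩ ⟨a', b'⟩ hle hm
    rw [Finset.mem_coe, mem_transpose] at hm ⊢
    have hl := h.1 t ht
    exact hl (a := (b, a)) ⟨hle.2, hle.1⟩ hm
  · rcases h.2.2 t ht with h | h | h
    · exact Or.inl (by simp only [h])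
    · exact Or.inr (Or.inl (hins _ _ h))
    · exact Or.inr (Or.inr (hins _ _ h))

/-! ### The correspondence `φ` -/

theorem tab_partner_self (α : Invol n) : tab (partner α) n = [] := by
  have h := (isPartialMatching_partner α).represents le_rfl
  have h2 : word (partner α) n = [] := by
    rw [List.eq_nil_iff_forall_not_mem]
    intro x hx
    obtain ⟨a, ha, rfl⟩ := mem_word.1 hx
    have := mem_alive.1 ha
    have := partner_lt α this.1
    omega
  have h3 := h.perm
  rw [h2, List.perm_nil] at h3
  cases hT : tab (partner α) n with
  | nil => rfl
  | cons R Rs =>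
    rw [hT] at h h3
    simp only [List.flatten_cons, List.append_eq_nil_iff] at h3
    exact absurd h3.1 h.1.1

/-- A sequence of shapes of an involution is determined by its terms of even rank. -/
theorem vacillating_eq_iff {α β : Invol n} {g : Finset (ℕ × ℕ) → Finset (ℕ × ℕ)}
    (hg : ∀ s s', g (s ∩ s') = g s ∩ g s') :
    (vacillating β = fun t => g (vacillating α t)) ↔
      ∀ t ≤ n, shape (tab (partner β) t) = g (shape (tab (partner α) t)) := by
  constructor
  · intro h t ht
    exact congrFun h ⟨2 * t, by omega⟩
  · intro h
    funext ⟨t, ht⟩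
    change shape (tableauSeq _ t) = g (shape (tableauSeq _ t))
    obtain ⟨s, rfl | rfl⟩ := Nat.even_or_odd' t
    · exact h s (by omega)
    · rw [shape_tableauSeq_odd (isPartialMatching_partner β) (by omega),
        shape_tableauSeq_odd (isPartialMatching_partner α) (by omega), hg, h s (by omega),
        h (s + 1) (by omega)]

theorem vacillating_injective : Function.Injective (vacillating (n := n)) := by
  intro α β h
  have h2 := (vacillating_eq_iff (g := id) fun _ _ => rfl).1 h
  exact invol_ext (partialMatching_unique (isPartialMatching_partner α)
    (isPartialMatching_partner β) h2 (by rw [tab_partner_self, tab_partner_self]))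

theorem vacillating_eq_transposeSeq_iff {α β : Invol n} :
    vacillating β = transposeSeq (vacillating α) ↔
      ∀ t ≤ n, shape (tab (partner β) t) = (shape (tab (partner α) t)).image Prod.swap :=
  vacillating_eq_iff fun s s' => Finset.image_inter s s' Prod.swap_injective

theorem exists_vacillating_eq (α : Invol n) :
    ∃ β : Invol n, vacillating β = transposeSeq (vacillating α) := by
  obtain ⟨p, h1, h2, h3⟩ := exists_partialMatching
    (isPartialMatching_partner α).isDiagramWalk.transpose (F := []) trivial (by simp) (by simp)
    (by rw [tab_partner_self]; rfl)
  have hp : ∀ a < n, p a < n ∧ p (p a) = a := by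
    intro a ha
    have hlt : p a < n := by
      by_contra hle
      have := (mem_flatten_tab h1 le_rfl).2 ⟨a, mem_alive.2 ⟨ha, not_lt.1 hle⟩, rfl⟩
      rw [h3] at this
      simp at this
    exact ⟨hlt, h1.1 a ha hlt⟩
  refine ⟨involOf p hp, vacillating_eq_transposeSeq_iff.2 fun t ht => ?_⟩
  rw [← h2 t ht]
  congr 1
  exact tab_congr fun a ha => partner_involOf hp (by omega)

/-! ### The correspondences with oscillating tableaux -/

/-- The last shape gives the number of open arcs, hence the entries of the last tableau and the
tableau itself; backward reconstruction then recovers all arcs. -/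
theorem oscRow_injective : Function.Injective (oscRow (n := n)) := by
  intro α β h
  have hα := isClosure_partnerNested α
  have hβ := isClosure_partnerNested β
  have hs : ∀ t ≤ n, shape (tab (partnerNested α) t) = shape (tab (partnerNested β) t) :=
    fun t ht => congrFun h ⟨t, by omega⟩
  have hm : numFixed α = numFixed β := by rw [← hα.card_shape, ← hβ.card_shape, hs n le_rfl]
  have tα := (hα.isPartialMatching.represents le_rfl).1
  have tβ := (hβ.isPartialMatching.represents le_rfl).1
  have hF : tab (partnerNested α) n = tab (partnerNested β) n := by
    refine tableau_eq_of_pairwise_flatten tα tβ (hs n le_rfl)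
      (tα.pairwise_flatten_of_row fun x hx => ((mem_shape_tab_partnerNested α).1 hx).1)
      (tβ.pairwise_flatten_of_row fun x hx => ((mem_shape_tab_partnerNested β).1 hx).1) ?_
    rw [hα.toFinset_flatten, hβ.toFinset_flatten, hm]
  have hpq := partialMatching_unique hα.isPartialMatching hβ.isPartialMatching hs hF
  refine invol_ext fun a ha => ?_
  have h1 := hα.lt_iff ha
  have h2 := hβ.lt_iff ha
  have h3 := hpq a ha
  rw [h3, h2] at h1
  by_cases e : partner α a = a
  · have := not_not.1 (h1.not.2 (not_not.2 e))
    rw [e, this]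
  · rw [← hα.eq_partner a ha e, h3, hβ.eq_partner a ha (h1.2 e)]

theorem oscColumn_injective : Function.Injective (oscColumn (n := n)) := by
  intro α β h
  have hα := isClosure_partnerCrossed α
  have hβ := isClosure_partnerCrossed β
  have hs : ∀ t ≤ n, shape (tab (partnerCrossed α) t) = shape (tab (partnerCrossed β) t) :=
    fun t ht => congrFun h ⟨t, by omega⟩
  have hm : numFixed α = numFixed β := by rw [← hα.card_shape, ← hβ.card_shape, hs n le_rfl]
  have tα := (hα.isPartialMatching.represents le_rfl).1
  have tβ := (hβ.isPartialMatching.represents le_rfl).1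
  have hF : tab (partnerCrossed α) n = tab (partnerCrossed β) n := by
    refine tableau_eq_of_pairwise_flatten tα tβ (hs n le_rfl)
      (tα.pairwise_flatten_of_column fun x hx => ((mem_shape_tab_partnerCrossed α).1 hx).2)
      (tβ.pairwise_flatten_of_column fun x hx => ((mem_shape_tab_partnerCrossed β).1 hx).2) ?_
    rw [hα.toFinset_flatten, hβ.toFinset_flatten, hm]
  have hpq := partialMatching_unique hα.isPartialMatching hβ.isPartialMatching hs hF
  refine invol_ext fun a ha => ?_
  have h1 := hα.lt_iff ha
  have h2 := hβ.lt_iff ha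
  have h3 := hpq a ha
  rw [h3, h2] at h1
  by_cases e : partner α a = a
  · have := not_not.1 (h1.not.2 (not_not.2 e))
    rw [e, this]
  · rw [← hα.eq_partner a ha e, h3, hβ.eq_partner a ha (h1.2 e)]

/-- Reconstruction starts from the column filled with the new dots. What has to be checked is that
the resulting partial matching is the crossed closure of an open matching. -/
theorem exists_oscColumn_eq (β : Invol n) :
    ∃ γ : Invol n, oscColumn γ = transposeSeq (oscRow β) := by
  have hβ := isClosure_partnerNested β
  set m := numFixed β
  have hshape : shape (columnTableau n m) =
      (shape (tab (partnerNested β) n)).image Prod.swap := by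
    ext ⟨r, c⟩
    rw [mem_shape_columnTableau, mem_transpose, mem_shape_tab_partnerNested]
    exact and_comm
  have hT := isTableau_columnTableau n m
  obtain ⟨p, h1, h2, h3⟩ := exists_partialMatching hβ.isPartialMatching.isDiagramWalk.transpose
    hT ((hT.pairwise_flatten_of_column fun x hx => ((mem_shape_columnTableau n m).1 hx).2).imp
      fun h => h.ne') (fun x hx => ((mem_flatten_columnTableau n m).1 hx).1) hshape
  have hval : ∀ x, (∃ a ∈ alive p n, p a = x) ↔ n ≤ x ∧ x < n + m := fun x => by
    rw [← mem_flatten_tab h1 le_rfl, h3, mem_flatten_columnTableau]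
  -- A closure has no isolated dot, so every step of its walk changes the number of cells; the
  -- transposed walk inherits this.
  have hne : ∀ a < n, p a ≠ a := by
    intro a ha e
    have h4 := h2 a (by omega)
    have h5 := h2 (a + 1) (by omega)
    rw [tab_succ_of_eq e, h4] at h5
    have h6 := congrArg Finset.card h5
    rw [card_transpose, card_transpose] at h6
    have h7 := card_shape_tab_lt_iff hβ.isPartialMatching ha
    have h8 := hβ.ne_self ha
    omega
  -- The last shape has `m` rows, so some `m` of the arcs leaving `n` cross one another; there are
  -- only `m` such arcs in all.
  have hmono : ∀ a ∈ alive p n, ∀ b ∈ alive p n, a < b → p a < p b := by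
    have hcard : (alive p n).card = m := by
      rw [← card_shape_tab h1 le_rfl, h2 n le_rfl, card_transpose, hβ.card_shape]
    rcases Nat.eq_zero_or_pos m with h0 | hpos
    · rw [h0, Finset.card_eq_zero] at hcard
      simp [hcard]
    · have hmem : (m - 1, 0) ∈ shape (tab p n) := by
        rw [h3, mem_shape_columnTableau]
        exact ⟨by simp only; omega, rfl⟩
      obtain ⟨S, hS, hc, hS'⟩ := (mem_shape_tab_zero h1 le_rfl).1 hmem
      rwa [Finset.eq_of_subset_of_card_le hS (by omega)] at hS'
  -- Arcs leaving the first `n` dots become fixed points, read as open arcs.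
  let g : ℕ → ℕ := fun a => if p a < n then p a else a
  have hg : ∀ a < n, g a < n ∧ g (g a) = a := by
    intro a ha
    by_cases hlt : p a < n
    · have h4 := h1.1 a ha hlt
      simp [g, hlt, h4, ha]
    · simp [g, hlt, ha]
  have hpart : ∀ a < n, partner (involOf g hg) a = g a := fun a ha => partner_involOf hg ha
  have hfix : fixedSet (involOf g hg) = alive p n := by
    ext a
    rw [mem_fixedSet, mem_alive]
    refine and_congr_right fun ha => ?_
    rw [hpart a ha]
    have := hne a ha
    by_cases hlt : p a < n
    · simp only [g, hlt, if_true]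
      omega
    · simpa [g, hlt] using not_lt.1 hlt
  refine ⟨involOf g hg, ?_⟩
  funext ⟨t, ht⟩
  change shape (tab _ t) = (shape (tab _ t)).image Prod.swap
  rw [← h2 t (by omega)]
  congr 1
  refine tab_congr fun a ha => ?_
  have han : a < n := by omega
  by_cases hlt : p a < n
  · rw [partnerCrossed, if_neg, hpart a han]
    · simp [g, hlt]
    · rw [hpart a han]
      simpa [g, hlt] using hne a han
  · have hal : a ∈ alive p n := mem_alive.2 ⟨han, by omega⟩
    rw [partnerCrossed_of_mem (hfix ▸ hal), fixedBefore_eq, hfix]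
    -- Right endpoints increase with left endpoints and fill an interval starting at `n`, so `p a -
    -- n` counts the open arcs before `a`, as `partnerCrossed` requires.
    have : ((alive p n).filter (· < a)).image p = Finset.Ico n (p a) := by
      ext x
      simp only [Finset.mem_image, Finset.mem_filter, Finset.mem_Ico]
      constructor
      · rintro ⟨b, ⟨hb, hba⟩, rfl⟩
        exact ⟨(mem_alive.1 hb).2, hmono b hb a hal hba⟩
      · rintro ⟨hx, hxa⟩
        have := (hval (p a)).1 ⟨a, hal, rfl⟩
        obtain ⟨b, hb, rfl⟩ := (hval x).2 ⟨hx, by omega⟩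
        refine ⟨b, ⟨hb, ?_⟩, rfl⟩
        by_contra hle
        rcases Nat.lt_or_eq_of_le (not_lt.1 hle) with h | rfl
        · have := hmono a hal b hb h
          omega
        · omega
    have hc := congrArg Finset.card this
    rw [Finset.card_image_of_injOn, Nat.card_Ico] at hc
    · omega
    · intro b hb c hc e
      simp only [Finset.coe_filter, Set.mem_ofPred_eq] at hb hc
      exact h1.2 b (mem_alive.1 hb.1).1 c (mem_alive.1 hc.1).1 e

/-! ### The maps `ψ`, `χ` and `θ` -/

theorem vacillating_psi (α : Invol n) : vacillating (psi α) = transposeSeq (vacillating α) :=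
  Function.invFun_eq (exists_vacillating_eq α)

theorem oscColumn_chi (β : Invol n) : oscColumn (chi β) = transposeSeq (oscRow β) :=
  Function.invFun_eq (exists_oscColumn_eq β)

theorem transposeSeq_injective {N : ℕ} : Function.Injective (transposeSeq (N := N)) := by
  intro s s' h
  funext t
  exact transpose_injective (congrFun h t)

theorem psi_injective : Function.Injective (psi (n := n)) := by
  intro α β h
  apply vacillating_injective
  apply transposeSeq_injective
  rw [← vacillating_psi, ← vacillating_psi, h]

theorem chi_injective : Function.Injective (chi (n := n)) := by
  intro α β h
  apply oscRow_injective
  apply transposeSeq_injective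
  rw [← oscColumn_chi, ← oscColumn_chi, h]

theorem shape_tab_psi (α : Invol n) {t : ℕ} (ht : t ≤ n) :
    shape (tab (partner (psi α)) t) = (shape (tab (partner α) t)).image Prod.swap :=
  vacillating_eq_transposeSeq_iff.1 (vacillating_psi α) t ht

theorem shape_tab_chi (β : Invol n) {t : ℕ} (ht : t ≤ n) :
    shape (tab (partnerCrossed (chi β)) t) =
      (shape (tab (partnerNested β) t)).image Prod.swap :=
  congrFun (oscColumn_chi β) ⟨t, by omega⟩

theorem partner_psi_lt_iff (α : Invol n) {a : ℕ} (ha : a < n) :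
    (partner (psi α) a < a ↔ partner α a < a) ∧ (a < partner (psi α) a ↔ a < partner α a) := by
  have h1 := card_shape_tab_lt_iff (isPartialMatching_partner (psi α)) ha
  have h2 := card_shape_tab_lt_iff (isPartialMatching_partner α) ha
  rw [shape_tab_psi α (by omega), shape_tab_psi α (by omega), card_transpose, card_transpose] at h1
  exact ⟨h1.1.symm.trans h2.1, h1.2.symm.trans h2.2⟩

/-- Only closers can be compared: in a closure an open arc looks like any other opener, and `chi`
may move the fixed points among the openers. -/
theorem partner_chi_lt_iff (β : Invol n) {a : ℕ} (ha : a < n) :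
    partner (chi β) a < a ↔ partner β a < a := by
  have h1 := card_shape_tab_lt_iff (isClosure_partnerCrossed (chi β)).isPartialMatching ha
  have h2 := card_shape_tab_lt_iff (isClosure_partnerNested β).isPartialMatching ha
  rw [shape_tab_chi β (by omega), shape_tab_chi β (by omega), card_transpose, card_transpose] at h1
  rw [← (isClosure_partnerCrossed (chi β)).lt_self_iff ha,
    ← (isClosure_partnerNested β).lt_self_iff ha]
  exact h1.1.symm.trans h2.1

theorem numFixed_psi (α : Invol n) : numFixed (psi α) = numFixed α := by
  rw [← card_fixedSet, ← card_fixedSet]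
  congr 1
  ext a
  rw [mem_fixedSet, mem_fixedSet]
  refine and_congr_right fun ha => ?_
  have := partner_psi_lt_iff α ha
  omega

theorem numFixed_chi (β : Invol n) : numFixed (chi β) = numFixed β := by
  rw [← (isClosure_partnerCrossed (chi β)).card_shape, ← (isClosure_partnerNested β).card_shape,
    shape_tab_chi β le_rfl, card_transpose]

theorem theta_bijective : Function.Bijective theta := by
  -- There are finitely many involutions of a given size, so injectivity suffices.
  have h : ∀ n, Function.Bijective fun α : Invol n => chi (psi α) := fun n =>
    Finite.injective_iff_bijective.1 (chi_injective.comp psi_injective)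
  constructor
  · rintro ⟨n, α⟩ ⟨m, β⟩ e
    obtain rfl : n = m := congrArg Sigma.fst e
    exact congrArg (Sigma.mk n) ((h n).1 (eq_of_heq (Sigma.mk.inj e).2))
  · rintro ⟨n, β⟩
    obtain ⟨α, rfl⟩ := (h n).2 β
    exact ⟨⟨n, α⟩, rfl⟩

theorem fixedCount_theta (α : Involution) : fixedCount (theta α) = fixedCount α :=
  (numFixed_chi _).trans (numFixed_psi _)

theorem openerCloser_theta (α : Involution) : openerCloser (theta α) = openerCloser α := by
  obtain ⟨n, α⟩ := α
  change List.ofFn (n := n) (fun i => decide (i ≤ (chi (psi α)).1 i)) =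
    List.ofFn fun i => decide (i ≤ α.1 i)
  congr 1
  funext i
  rw [decide_eq_decide, Fin.le_def, Fin.le_def, ← partner_val, ← partner_val, ← not_lt, ← not_lt,
    partner_chi_lt_iff _ i.2, (partner_psi_lt_iff α i.2).1]

/-! ### Nesting levels in terms of numbers of arcs -/

open Classical in
/-- The maximal cardinality of a set with the property `P`. -/
noncomputable def maxCard {n : ℕ} (P : Finset (Fin n) → Prop) : ℕ :=
  (Finset.univ.filter P).sup Finset.card

theorem le_maxCard {P : Finset (Fin n) → Prop} {S : Finset (Fin n)} (h : P S) :
    S.card ≤ maxCard P :=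
  Finset.le_sup (f := Finset.card) (by simpa using h)

theorem exists_card_eq_maxCard {P : Finset (Fin n) → Prop} (h : P ∅) :
    ∃ S, P S ∧ S.card = maxCard P := by
  classical
  obtain ⟨S, hS, e⟩ := Finset.exists_mem_eq_sup (Finset.univ.filter P) ⟨∅, by simpa using h⟩
    Finset.card
  refine ⟨S, by simpa using hS, ?_⟩
  rw [← e, maxCard]

/-- The set `S` consists of the left endpoints of mutually nesting arcs. -/
def IsArcNesting (α : Invol n) (S : Finset (Fin n)) : Prop :=
  (∀ i ∈ S, i < α.1 i) ∧ ∀ i ∈ S, ∀ j ∈ S, i < j → α.1 j < α.1 i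

theorem dots_eq {α : Invol n} {S : Finset (Fin n)} (h : ∀ i ∈ S, i ≤ α.1 i) :
    dots α S = S.card + (S.filter fun i => i < α.1 i).card := by
  have hu : (S ∪ S.image fun i => α.1 i) =
      S ∪ (S.filter fun i => i < α.1 i).image fun i => α.1 i := by
    ext x
    simp only [Finset.mem_union, Finset.mem_image, Finset.mem_filter]
    constructor
    · rintro (hx | ⟨i, hi, rfl⟩)
      · exact Or.inl hx
      · rcases (h i hi).lt_or_eq with hlt | heq
        · exact Or.inr ⟨i, ⟨hi, hlt⟩, rfl⟩
        · exact Or.inl (heq ▸ hi)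
    · rintro (hx | ⟨i, ⟨hi, _⟩, rfl⟩)
      · exact Or.inl hx
      · exact Or.inr ⟨i, hi, rfl⟩
  rw [dots, hu, Finset.card_union_of_disjoint, Finset.card_image_of_injective _ α.1.injective]
  rw [Finset.disjoint_left]
  intro x hx hx'
  obtain ⟨i, hi, rfl⟩ := Finset.mem_image.1 hx'
  have h1 := h _ hx
  rw [α.2] at h1
  exact absurd (Finset.mem_filter.1 hi).2 (not_lt.2 h1)

/-- Families of nested arcs to which at most one fixed point can be added. -/
structure IsNestingFamily (α : Invol n) (P : Finset (Fin n) → Prop) : Prop where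
  of_isArcNesting : ∀ S, IsArcNesting α S → P S
  le : ∀ S, P S → ∀ i ∈ S, i ≤ α.1 i
  filter : ∀ S, P S → IsArcNesting α (S.filter fun i => i < α.1 i)
  card_fixed : ∀ S, P S → (S.filter fun i => ¬ i < α.1 i).card ≤ 1

open Classical in
-- A family has as many dots as members plus true arcs, which bounds the supremum by the sum of the
-- two maxima. The bound is reached by a largest arc nesting if the maxima agree. Otherwise a
-- largest family has one member more than any arc nesting, hence one fixed point and a largest arc
-- nesting.
theorem IsNestingFamily.sup_dots {α : Invol n} {P : Finset (Fin n) → Prop}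
    (h : IsNestingFamily α P) :
    maxCard (IsArcNesting α) ≤ maxCard P ∧ maxCard P ≤ maxCard (IsArcNesting α) + 1 ∧
    (Finset.univ.filter P).sup (dots α) = maxCard (IsArcNesting α) + maxCard P := by
  have h0 : IsArcNesting α ∅ := by simp [IsArcNesting]
  have hsplit : ∀ S : Finset (Fin n), (S.filter fun i => i < α.1 i).card +
      (S.filter fun i => ¬ i < α.1 i).card = S.card := fun S =>
    Finset.card_filter_add_card_filter_not _
  obtain ⟨S, hS, eS⟩ := exists_card_eq_maxCard h0
  obtain ⟨M, hM, eM⟩ := exists_card_eq_maxCard (h.of_isArcNesting ∅ h0)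
  have h1 := le_maxCard (h.of_isArcNesting S hS)
  have h2 := le_maxCard (h.filter M hM)
  have h3 := h.card_fixed M hM
  have h4 := hsplit M
  refine ⟨by omega, by omega, le_antisymm ?_ ?_⟩
  · apply Finset.sup_le
    intro U hU
    have hU : P U := by simpa using hU
    rw [dots_eq (h.le U hU)]
    have h5 := le_maxCard (h.filter U hU)
    have h6 := le_maxCard hU
    omega
  · by_cases hlt : maxCard P = maxCard (IsArcNesting α)
    · have hPS := h.of_isArcNesting S hS
      have h5 : dots α S ≤ (Finset.univ.filter P).sup (dots α) :=
        Finset.le_sup (f := dots α) (by simpa using hPS)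
      rw [dots_eq (h.le S hPS), Finset.filter_true_of_mem hS.1] at h5
      omega
    · have h5 : dots α M ≤ (Finset.univ.filter P).sup (dots α) :=
        Finset.le_sup (f := dots α) (by simpa using hM)
      rw [dots_eq (h.le M hM)] at h5
      omega

theorem isNestingFamily_enhanced (α : Invol n) : IsNestingFamily α (IsEnhancedNesting α) where
  of_isArcNesting S h := ⟨fun i hi => (h.1 i hi).le, h.2⟩
  le S h := h.1
  filter S h := ⟨fun i hi => (Finset.mem_filter.1 hi).2, fun i hi j hj =>
    h.2 i (Finset.mem_filter.1 hi).1 j (Finset.mem_filter.1 hj).1⟩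
  card_fixed S h := by
    rw [Finset.card_le_one]
    intro i hi j hj
    rw [Finset.mem_filter, not_lt] at hi hj
    have ei := le_antisymm hi.2 (h.1 i hi.1)
    have ej := le_antisymm hj.2 (h.1 j hj.1)
    rcases lt_trichotomy i j with hlt | heq | hlt
    · have := h.2 i hi.1 j hj.1 hlt
      rw [ei, ej] at this
      exact absurd hlt this.asymm
    · exact heq
    · have := h.2 j hj.1 i hi.1 hlt
      rw [ei, ej] at this
      exact absurd hlt this.asymm

theorem isNestingFamily_open (α : Invol n) : IsNestingFamily α (IsOpenNesting α) where
  of_isArcNesting S h :=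
    ⟨fun i hi => (h.1 i hi).le, fun i hi j hj hij => ⟨h.1 j hj, Or.inr (h.2 i hi j hj hij)⟩⟩
  le S h := h.1
  filter S h := ⟨fun i hi => (Finset.mem_filter.1 hi).2, fun i hi j hj hij => by
    rw [Finset.mem_filter] at hi hj
    exact (h.2 i hi.1 j hj.1 hij).2.resolve_left hi.2.ne'⟩
  card_fixed S h := by
    rw [Finset.card_le_one]
    intro i hi j hj
    rw [Finset.mem_filter] at hi hj
    rcases lt_trichotomy i j with hlt | heq | hlt
    · exact absurd (h.2 i hi.1 j hj.1 hlt).1 hj.2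
    · exact heq
    · exact absurd (h.2 j hj.1 i hi.1 hlt).1 hi.2

/-- The maximal number of arcs in a nesting. -/
noncomputable def nest (α : Involution) : ℕ := maxCard (IsArcNesting α.2)

/-- The maximal number of arcs in an enhanced nesting, fixed points being counted as arcs. -/
noncomputable def enhNest (α : Involution) : ℕ := maxCard (IsEnhancedNesting α.2)

/-- The maximal number of arcs in an open nesting, open arcs included. -/
noncomputable def openNest (α : Involution) : ℕ := maxCard (IsOpenNesting α.2)

theorem enhne_eq (α : Involution) :
    nest α ≤ enhNest α ∧ enhNest α ≤ nest α + 1 ∧ enhne α = nest α + enhNest α :=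
  (isNestingFamily_enhanced α.2).sup_dots

theorem futne_eq (α : Involution) :
    nest α ≤ openNest α ∧ openNest α ≤ nest α + 1 ∧ futne α = nest α + openNest α :=
  (isNestingFamily_open α.2).sup_dots

theorem lt_maxCard_iff {P : Finset (Fin n) → Prop} {Q : Finset ℕ → Prop}
    (h : ∀ S, P S ↔ Q (S.map Fin.valEmbedding)) {k : ℕ} :
    k < maxCard P ↔ ∃ S ⊆ Finset.range n, Q S ∧ k < S.card := by
  classical
  rw [maxCard, Finset.lt_sup_iff]
  constructor
  · rintro ⟨S, hS, hk⟩
    refine ⟨S.map Fin.valEmbedding, ?_, (h S).1 (by simpa using hS), by simpa using hk⟩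
    intro a ha
    obtain ⟨i, _, rfl⟩ := Finset.mem_map.1 ha
    simp
  · rintro ⟨S, hS, hQ, hk⟩
    have e : S = (Finset.univ.filter fun i : Fin n => (i : ℕ) ∈ S).map Fin.valEmbedding := by
      ext a
      simp only [Finset.mem_map, Finset.mem_filter, Finset.mem_univ, true_and,
        Fin.valEmbedding_apply]
      constructor
      · exact fun ha => ⟨⟨a, Finset.mem_range.1 (hS ha)⟩, ha, rfl⟩
      · rintro ⟨i, hi, rfl⟩
        exact hi
    rw [e] at hQ hk
    exact ⟨_, by simpa using (h _).2 hQ, by simpa using hk⟩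

theorem lt_enhNest_iff (α : Invol n) {k : ℕ} : k < enhNest ⟨n, α⟩ ↔ ∃ S ⊆ Finset.range n,
    ((∀ a ∈ S, a ≤ partner α a) ∧ ∀ a ∈ S, ∀ b ∈ S, a < b → partner α b < partner α a) ∧
      k < S.card := by
  apply lt_maxCard_iff
  intro S
  simp [IsEnhancedNesting, partner_val]

theorem lt_openNest_iff (α : Invol n) {k : ℕ} : k < openNest ⟨n, α⟩ ↔ ∃ S ⊆ Finset.range n,
    ((∀ a ∈ S, a ≤ partner α a) ∧ ∀ a ∈ S, ∀ b ∈ S, a < b → b < partner α b ∧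
      (partner α a = a ∨ partner α b < partner α a)) ∧ k < S.card := by
  apply lt_maxCard_iff
  intro S
  simp [IsOpenNesting, partner_val, Fin.ext_iff]

/-! ### Nesting levels and shapes -/

/-- The diagram `s` has at least `k` columns. -/
def HasColumns (s : Finset (ℕ × ℕ)) (k : ℕ) : Prop := ∀ j < k, (0, j) ∈ s

/-- The diagram `s` has at least `k` rows. -/
def HasRows (s : Finset (ℕ × ℕ)) (k : ℕ) : Prop := ∀ j < k, (j, 0) ∈ s

theorem hasRows_transpose {s : Finset (ℕ × ℕ)} {k : ℕ} :
    HasRows (s.image Prod.swap) k ↔ HasColumns s k := by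
  simp only [HasRows, HasColumns, mem_transpose]

theorem hasColumns_transpose {s : Finset (ℕ × ℕ)} {k : ℕ} :
    HasColumns (s.image Prod.swap) k ↔ HasRows s k := by
  simp only [HasRows, HasColumns, mem_transpose]

theorem hasColumns_tab {p : ℕ → ℕ} (hp : IsPartialMatching n p) {t : ℕ} (ht : t ≤ n) {k : ℕ} :
    HasColumns (shape (tab p t)) k ↔ ∃ S ⊆ alive p t, S.card = k ∧
      ∀ a ∈ S, ∀ b ∈ S, a < b → p b < p a := by
  constructor
  · intro h
    cases k with
    | zero => exact ⟨∅, by simp, rfl, by simp⟩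
    | succ k => exact (zero_mem_shape_tab hp ht).1 (h k (by omega))
  · rintro ⟨S, h1, h2, h3⟩ j hj
    obtain ⟨U, hU, hc⟩ := Finset.exists_subset_card_eq (s := S) (n := j + 1) (by omega)
    exact (zero_mem_shape_tab hp ht).2
      ⟨U, hU.trans h1, hc, fun a ha b hb => h3 a (hU ha) b (hU hb)⟩

theorem hasRows_tab {p : ℕ → ℕ} (hp : IsPartialMatching n p) {t : ℕ} (ht : t ≤ n) {k : ℕ} :
    HasRows (shape (tab p t)) k ↔ ∃ S ⊆ alive p t, S.card = k ∧
      ∀ a ∈ S, ∀ b ∈ S, a < b → p a < p b := by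
  constructor
  · intro h
    cases k with
    | zero => exact ⟨∅, by simp, rfl, by simp⟩
    | succ k => exact (mem_shape_tab_zero hp ht).1 (h k (by omega))
  · rintro ⟨S, h1, h2, h3⟩ j hj
    obtain ⟨U, hU, hc⟩ := Finset.exists_subset_card_eq (s := S) (n := j + 1) (by omega)
    exact (mem_shape_tab_zero hp ht).2
      ⟨U, hU.trans h1, hc, fun a ha b hb => h3 a (hU ha) b (hU hb)⟩

/-- An arc over the gap before an isolated dot also passes over the dot itself. -/
theorem ne_of_mem_alive_partner {α : Invol n} {a t : ℕ} (ht : t < n)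
    (he : partner α t = t) (ha : a ∈ alive (partner α) t) : partner α a ≠ t := by
  intro e
  have := mem_alive.1 ha
  have := partner_partner α (a := a) (by omega)
  rw [e, he] at this
  omega

/-- Enhanced nestings and widths of the shapes of an arc diagram. -/
theorem lt_enhNest_iff_hasColumns (α : Invol n) {k : ℕ} : k < enhNest ⟨n, α⟩ ↔
    (∃ t ≤ n, HasColumns (shape (tab (partner α) t)) (k + 1)) ∨
      ∃ t < n, partner α t = t ∧ HasColumns (shape (tab (partner α) t)) k := by
  have hp := isPartialMatching_partner α
  rw [lt_enhNest_iff]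
  constructor
  · rintro ⟨S', hS', ⟨h1, h2⟩, hk⟩
    obtain ⟨S, hS, hc⟩ := Finset.exists_subset_card_eq (Nat.succ_le_of_lt hk)
    have hne : S.Nonempty := Finset.card_pos.1 (by omega)
    have hj := S.max'_mem hne
    set j := S.max' hne
    have hjn : j < n := Finset.mem_range.1 (hS' (hS hj))
    -- The member `j` with the largest left endpoint is the innermost. If it is a fixed point, the
    -- other arcs pass over it; if not, all arcs pass over the gap just after `j`.
    by_cases e : partner α j = j
    · refine Or.inr ⟨j, hjn, e, (hasColumns_tab hp hjn.le).2 ⟨S.erase j, ?_, ?_, ?_⟩⟩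
      · intro a ha
        have hlt := lt_of_le_of_ne (S.le_max' a (Finset.mem_of_mem_erase ha))
          (Finset.ne_of_mem_erase ha)
        have := h2 a (hS (Finset.mem_of_mem_erase ha)) j (hS hj) hlt
        exact mem_alive.2 ⟨hlt, by omega⟩
      · rw [Finset.card_erase_of_mem hj]
        omega
      · exact fun a ha b hb => h2 a (hS (Finset.mem_of_mem_erase ha)) b
          (hS (Finset.mem_of_mem_erase hb))
    · refine Or.inl ⟨j + 1, hjn, (hasColumns_tab hp hjn).2
        ⟨S, ?_, hc, fun a ha b hb => h2 a (hS ha) b (hS hb)⟩⟩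
      intro a ha
      have hle := S.le_max' a ha
      have hj1 := h1 j (hS hj)
      refine mem_alive.2 ⟨Nat.lt_succ_of_le hle, ?_⟩
      rcases hle.lt_or_eq with hlt | heq
      · have := h2 a (hS ha) j (hS hj) hlt
        omega
      · rw [heq]
        change j + 1 ≤ partner α j
        omega
  · rintro (⟨t, ht, h⟩ | ⟨t, ht, he, h⟩)
    · obtain ⟨S, hS, hc, h⟩ := (hasColumns_tab hp ht).1 h
      refine ⟨S, fun a ha => ?_, ⟨fun a ha => ?_, h⟩, by omega⟩
      · have := mem_alive.1 (hS ha)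
        exact Finset.mem_range.2 (by omega)
      · have := mem_alive.1 (hS ha)
        omega
    · obtain ⟨S, hS, hc, h⟩ := (hasColumns_tab hp ht.le).1 h
      have htS : t ∉ S := fun h => lt_irrefl t (mem_alive.1 (hS h)).1
      refine ⟨insert t S, fun a ha => ?_, ⟨fun a ha => ?_, fun a ha b hb hab => ?_⟩, ?_⟩
      · rcases Finset.mem_insert.1 ha with rfl | ha
        · exact Finset.mem_range.2 ht
        · have := mem_alive.1 (hS ha)
          exact Finset.mem_range.2 (by omega)
      · rcases Finset.mem_insert.1 ha with rfl | ha
        · exact he.ge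
        · have := mem_alive.1 (hS ha)
          omega
      · rcases Finset.mem_insert.1 ha with rfl | ha' <;>
          rcases Finset.mem_insert.1 hb with rfl | hb'
        · omega
        · have := mem_alive.1 (hS hb')
          omega
        · have := mem_alive.1 (hS ha')
          have := ne_of_mem_alive_partner ht he (hS ha')
          omega
        · exact h a ha' b hb' hab
      · rw [Finset.card_insert_of_notMem htS]
        omega

/-- Heights of the shapes of an arc diagram, and of its closure by nested arcs. -/
theorem hasRows_partnerNested_iff (β : Invol n) {k : ℕ} :
    (∃ t ≤ n, HasRows (shape (tab (partnerNested β) t)) (k + 1)) ↔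
    (∃ t ≤ n, HasRows (shape (tab (partner β) t)) (k + 1)) ∨
      ∃ t < n, partner β t = t ∧ HasRows (shape (tab (partner β) t)) k := by
  have hp := isPartialMatching_partner β
  have hq := isClosure_partnerNested β
  constructor
  · rintro ⟨t, ht, h⟩
    obtain ⟨S, hS, hc, h⟩ := (hasRows_tab hq.isPartialMatching ht).1 h
    have hlt : ∀ a ∈ S, a < n := fun a ha => by
      have := mem_alive.1 (hS ha)
      omega
    by_cases hex : ∃ a ∈ S, partner β a = a
    · obtain ⟨a, ha, e⟩ := hex
      have haf := mem_fixedSet.2 ⟨hlt a ha, e⟩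
      -- New arcs are nested, so a crossing set contains at most one of them. It ends after all old
      -- dots, so in a crossing it must also start last.
      have hkey : ∀ b ∈ S, b ≠ a → b < a ∧ partner β b ≠ b := by
        intro b hb hne
        have hbne : partner β b ≠ b := by
          intro e'
          have hbf := mem_fixedSet.2 ⟨hlt b hb, e'⟩
          rcases lt_or_gt_of_ne hne with hba | hba
          · exact (partnerNested_anti hbf haf hba).asymm (h b hb a ha hba)
          · exact (partnerNested_anti haf hbf hba).asymm (h a ha b hb hba)
        refine ⟨lt_of_le_of_ne (not_lt.1 fun hab => ?_) hne, hbne⟩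
        have h1 := h a ha b hb hab
        have h2 := (hq.lt_iff (hlt b hb)).2 hbne
        have h3 := hq.le a haf
        omega
      refine Or.inr ⟨a, hlt a ha, e, (hasRows_tab hp (hlt a ha).le).2 ⟨S.erase a, ?_, ?_, ?_⟩⟩
      · intro b hb
        obtain ⟨hne, hbS⟩ := Finset.mem_erase.1 hb
        obtain ⟨h1, h2⟩ := hkey b hbS hne
        have h3 := mem_alive.1 (hS hbS)
        have h4 := mem_alive.1 (hS ha)
        rw [hq.eq_partner b (hlt b hbS) h2] at h3
        exact mem_alive.2 ⟨h1, by omega⟩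
      · rw [Finset.card_erase_of_mem ha]
        omega
      · intro b hb c hc hbc
        obtain ⟨hb1, hb2⟩ := Finset.mem_erase.1 hb
        obtain ⟨hc1, hc2⟩ := Finset.mem_erase.1 hc
        rw [← hq.eq_partner b (hlt b hb2) (hkey b hb2 hb1).2,
          ← hq.eq_partner c (hlt c hc2) (hkey c hc2 hc1).2]
        exact h b hb2 c hc2 hbc
    · push Not at hex
      have heq : ∀ a ∈ S, partnerNested β a = partner β a := fun a ha =>
        hq.eq_partner a (hlt a ha) (hex a ha)
      refine Or.inl ⟨t, ht, (hasRows_tab hp ht).2 ⟨S, fun a ha => ?_, hc, fun a ha b hb hab => ?_⟩⟩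
      · have := mem_alive.1 (hS ha)
        rw [heq a ha] at this
        exact mem_alive.2 this
      · rw [← heq a ha, ← heq b hb]
        exact h a ha b hb hab
  · have heq : ∀ t ≤ n, ∀ a ∈ alive (partner β) t, partnerNested β a = partner β a := by
      intro t ht a ha
      have := mem_alive.1 ha
      exact hq.eq_partner a (by omega) (by omega)
    rintro (⟨t, ht, h⟩ | ⟨t, ht, he, h⟩)
    · obtain ⟨S, hS, hc, h⟩ := (hasRows_tab hp ht).1 h
      refine ⟨t, ht, (hasRows_tab hq.isPartialMatching ht).2
        ⟨S, fun a ha => ?_, hc, fun a ha b hb hab => ?_⟩⟩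
      · have := mem_alive.1 (hS ha)
        rw [← heq t ht a (hS ha)] at this
        exact mem_alive.2 this
      · rw [heq t ht a (hS ha), heq t ht b (hS hb)]
        exact h a ha b hb hab
    · obtain ⟨S, hS, hc, h⟩ := (hasRows_tab hp ht.le).1 h
      have htS : t ∉ S := fun h => lt_irrefl t (mem_alive.1 (hS h)).1
      have htq := hq.le t (mem_fixedSet.2 ⟨ht, he⟩)
      -- All the arcs over the isolated dot `t` end after it, so they and the new arc starting at
      -- `t` pass over the next gap and cross.
      refine ⟨t + 1, ht, (hasRows_tab hq.isPartialMatching ht).2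
        ⟨insert t S, fun a ha => ?_, ?_, fun a ha b hb hab => ?_⟩⟩
      · rcases Finset.mem_insert.1 ha with rfl | ha
        · exact mem_alive.2 ⟨by omega, by omega⟩
        · have h1 := mem_alive.1 (hS ha)
          have h2 := ne_of_mem_alive_partner ht he (hS ha)
          rw [mem_alive, heq t ht.le a (hS ha)]
          omega
      · rw [Finset.card_insert_of_notMem htS, hc]
      · rcases Finset.mem_insert.1 ha with rfl | ha' <;>
          rcases Finset.mem_insert.1 hb with rfl | hb'
        · omega
        · have := mem_alive.1 (hS hb')
          omega
        · have h1 := mem_alive.1 (hS ha')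
          rw [heq b ht.le a (hS ha')]
          have := partner_lt β (a := a) (by omega)
          omega
        · rw [heq t ht.le a (hS ha'), heq t ht.le b (hS hb')]
          exact h a ha' b hb' hab

/-- Open nestings and widths of the shapes of the closure by crossing arcs. -/
theorem lt_openNest_iff_hasColumns (γ : Invol n) {k : ℕ} : k < openNest ⟨n, γ⟩ ↔
    ∃ t ≤ n, HasColumns (shape (tab (partnerCrossed γ) t)) (k + 1) := by
  have hq := isClosure_partnerCrossed γ
  rw [lt_openNest_iff]
  constructor
  · rintro ⟨S', hS', ⟨h1, h2⟩, hk⟩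
    obtain ⟨S, hS, hc⟩ := Finset.exists_subset_card_eq (Nat.succ_le_of_lt hk)
    have hlt : ∀ a ∈ S, a < n := fun a ha => Finset.mem_range.1 (hS' (hS ha))
    have hne : S.Nonempty := Finset.card_pos.1 (by omega)
    have hj := S.max'_mem hne
    have hmax : ∀ a ∈ S, a ≤ S.max' hne := S.le_max'
    generalize S.max' hne = j at hj hmax
    have hjn := hlt j hj
    refine ⟨j + 1, hjn, (hasColumns_tab hq.isPartialMatching hjn).2
      ⟨S, fun a ha => ?_, hc, fun a ha b hb hab => ?_⟩⟩
    · have hle : a ≤ j := hmax a ha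
      refine mem_alive.2 ⟨by omega, ?_⟩
      by_cases e : partner γ a = a
      · have := hq.le a (mem_fixedSet.2 ⟨hlt a ha, e⟩)
        omega
      · rw [hq.eq_partner a (hlt a ha) e]
        have h3 := h1 a (hS ha)
        rcases hle.lt_or_eq with hlt' | rfl
        · have h4 := h2 a (hS ha) j (hS hj) hlt'
          omega
        · omega
    · obtain ⟨h3, h4⟩ := h2 a (hS ha) b (hS hb) hab
      rw [hq.eq_partner b (hlt b hb) h3.ne']
      by_cases e : partner γ a = a
      · have := hq.le a (mem_fixedSet.2 ⟨hlt a ha, e⟩)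
        have := partner_lt γ (hlt b hb)
        omega
      · rw [hq.eq_partner a (hlt a ha) e]
        exact h4.resolve_left e
  · rintro ⟨t, ht, h⟩
    obtain ⟨S, hS, hc, h⟩ := (hasColumns_tab hq.isPartialMatching ht).1 h
    have hlt : ∀ a ∈ S, a < n := fun a ha => by
      have := mem_alive.1 (hS ha)
      omega
    have hgt : ∀ a ∈ S, partner γ a ≠ a → a < partner γ a := fun a ha e => by
      have := mem_alive.1 (hS ha)
      rw [hq.eq_partner a (hlt a ha) e] at this
      omega
    refine ⟨S, fun a ha => Finset.mem_range.2 (hlt a ha), ⟨fun a ha => ?_,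
      fun a ha b hb hab => ?_⟩, by omega⟩
    · by_cases e : partner γ a = a
      · exact e.ge
      · exact (hgt a ha e).le
    · have h1 := h a ha b hb hab
      -- If the inner arc `b` were new, the outer arc `a` would end even later and be new as well,
      -- but new arcs cross.
      have hbne : partner γ b ≠ b := by
        intro e
        have hbf := mem_fixedSet.2 ⟨hlt b hb, e⟩
        have h2 := hq.le b hbf
        have h3 := (hq.lt_iff (hlt a ha)).not.1 (by omega)
        exact h1.asymm (partnerCrossed_mono (mem_fixedSet.2 ⟨hlt a ha, not_not.1 h3⟩) hbf hab)
      refine ⟨hgt b hb hbne, or_iff_not_imp_left.2 fun e => ?_⟩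
      rwa [← hq.eq_partner a (hlt a ha) e, ← hq.eq_partner b (hlt b hb) hbne]

/-- Widths become heights under `psi`, which fixes every fixed point; `hasRows_partnerNested_iff`
absorbs the fixed points into the closure, and `chi` turns heights back into widths. -/
theorem openNest_theta (α : Involution) : openNest (theta α) = enhNest α := by
  obtain ⟨n, α⟩ := α
  refine eq_of_forall_lt_iff fun k => ?_
  rw [theta, lt_openNest_iff_hasColumns, lt_enhNest_iff_hasColumns]
  have h1 : (∃ t ≤ n, HasColumns (shape (tab (partnerCrossed (chi (psi α))) t)) (k + 1)) ↔
      ∃ t ≤ n, HasRows (shape (tab (partnerNested (psi α)) t)) (k + 1) := by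
    refine exists_congr fun t => and_congr_right fun ht => ?_
    rw [shape_tab_chi _ ht, hasColumns_transpose]
  rw [h1, hasRows_partnerNested_iff]
  refine or_congr (exists_congr fun t => and_congr_right fun ht => ?_)
    (exists_congr fun t => and_congr_right fun ht => and_congr ?_ ?_)
  · rw [shape_tab_psi α ht, hasRows_transpose]
  · have := partner_psi_lt_iff α ht
    omega
  · rw [shape_tab_psi α ht.le, hasRows_transpose]

/-! ### Steps up and down along the orbits of a permutation -/

section
variable {X : Type*} {Θ : Equiv.Perm X} {E F : X → ℕ}

/-- If `F` changes by at most one along the cycles of `Θ`, a step from `k + 1` down to `k` is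
followed by a step from `k` up to `k + 1`. The first step up after the step down is also
preceded by this step down, which is the last one before it. -/
theorem exists_isLeast_step_up (hE : ∀ x, F (Θ x) = E x) (hle : ∀ x, E x ≤ F x + 1)
    (hper : ∀ x, ∃ N, 1 ≤ N ∧ (Θ ^ N) x = x) {k : ℕ} {x : X} (h1 : E x = k) (h2 : F x = k + 1) :
    ∃ m, 1 ≤ m ∧ IsLeast {m : ℕ | E ((Θ ^ m) x) = k + 1 ∧ F ((Θ ^ m) x) = k} m ∧
      IsLeast {j : ℕ | E ((Θ⁻¹ ^ j) ((Θ ^ m) x)) = k ∧ F ((Θ⁻¹ ^ j) ((Θ ^ m) x)) = k + 1} m := by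
  have hsucc : ∀ j, F ((Θ ^ (j + 1)) x) = E ((Θ ^ j) x) := fun j => by
    rw [pow_succ', Equiv.Perm.mul_apply, hE]
  -- Periodicity brings `F` back to `k + 1`. Let `j` be the first positive time at which `F` is at
  -- least `k + 1`: strictly between, `F` is at most `k`, and as it rises by at most one, the step
  -- from `j - 1` to `j` goes from `k` to `k + 1`.
  have hex : ∃ j, 1 ≤ j ∧ k + 1 ≤ F ((Θ ^ j) x) := by
    obtain ⟨N, hN, e⟩ := hper x
    exact ⟨N, hN, by rw [e, h2]⟩
  obtain ⟨hj1, hj2⟩ := Nat.find_spec hex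
  have hmin : ∀ i, 1 ≤ i → i < Nat.find hex → F ((Θ ^ i) x) ≤ k := fun i hi hlt => by
    by_contra hcon
    exact Nat.find_min hex hlt ⟨hi, by omega⟩
  generalize Nat.find hex = j at hj1 hj2 hmin
  obtain ⟨m, rfl⟩ : ∃ m, j = m + 1 := ⟨j - 1, by omega⟩
  rw [hsucc] at hj2
  have hm : 1 ≤ m := by
    rcases Nat.eq_zero_or_pos m with rfl | hpos
    · simp only [pow_zero, Equiv.Perm.one_apply] at hj2
      omega
    · exact hpos
  have h3 := hmin m hm (by omega)
  have h4 := hle ((Θ ^ m) x)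
  have hback : ∀ i ≤ m, (Θ⁻¹ ^ i) ((Θ ^ m) x) = (Θ ^ (m - i)) x := by
    intro i hi
    have e : Θ ^ m = Θ ^ i * Θ ^ (m - i) := by rw [← pow_add, Nat.add_sub_cancel' hi]
    rw [e, ← Equiv.Perm.mul_apply, ← mul_assoc, inv_pow, inv_mul_cancel, one_mul]
  refine ⟨m, hm, ⟨⟨by omega, by omega⟩, fun i hi => ?_⟩, ⟨?_, fun i hi => ?_⟩⟩
  -- An earlier step up would make `F` reach `k + 1` before time `m + 1`; a later step down than the
  -- one at `x` would start from the value `k + 1` at an intermediate time.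
  · by_contra hlt
    have hi1 := hi.1
    rw [← hsucc] at hi1
    have := hmin (i + 1) (by omega) (by omega)
    omega
  · rw [Set.mem_ofPred_eq, hback m le_rfl, Nat.sub_self]
    exact ⟨h1, h2⟩
  · by_contra hlt
    have hi2 := hi.2
    rw [hback i (by omega)] at hi2
    have := hmin (m - i) (by omega) (by omega)
    omega

theorem zpow_invariant {Y : Type*} {g : X → Y} (h : ∀ x, g (Θ x) = g x) (z : ℤ) (x : X) :
    g ((Θ ^ z) x) = g x := by
  induction z generalizing x with
  | zero => rfl
  | succ i ih => rw [zpow_add_one, Equiv.Perm.mul_apply, ih, h]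
  | pred i ih =>
    rw [zpow_sub_one, Equiv.Perm.mul_apply, ih, ← h, ← Equiv.Perm.mul_apply, mul_inv_cancel,
      Equiv.Perm.one_apply]

end

/-! ### The exponents `m_α` -/

/-- An even `enhne` forces `enhNest = nest` and an odd `futne` forces `openNest = nest + 1`; so
`nest = k`. Conversely, the two given values leave only `k` for `nest`. -/
theorem mem_A_even_odd {α : Involution} {k : ℕ} :
    α ∈ A (2 * k) (2 * k + 1) ↔ enhNest α = k ∧ openNest α = k + 1 := by
  have h1 := enhne_eq α
  have h2 := futne_eq α
  change enhne α = 2 * k ∧ futne α = 2 * k + 1 ↔ _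
  omega

theorem mem_A_odd_even {α : Involution} {k : ℕ} :
    α ∈ A (2 * k + 1) (2 * k) ↔ enhNest α = k + 1 ∧ openNest α = k := by
  have h1 := enhne_eq α
  have h2 := futne_eq α
  change enhne α = 2 * k + 1 ∧ futne α = 2 * k ↔ _
  omega

theorem enhne_eq_futne {α : Involution} (h1 : ¬ ∃ k, α ∈ A (2 * k) (2 * k + 1))
    (h2 : ¬ ∃ k, α ∈ A (2 * k + 1) (2 * k)) : enhne α = futne α := by
  simp only [mem_A_even_odd, mem_A_odd_even, not_exists] at h1 h2
  have h3 := h1 (enhNest α)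
  have h4 := h2 (openNest α)
  have h5 := enhne_eq α
  have h6 := futne_eq α
  omega

/-! ### Evaluating the exponents -/

theorem zpow_neg_natCast_apply (Θ : Equiv.Perm Involution) (m : ℕ) :
    Θ ^ (-(m : ℤ)) = Θ⁻¹ ^ m := by rw [zpow_neg, zpow_natCast, inv_pow]

theorem swapExponent_of_even_odd {Θ : Equiv.Perm Involution} {α : Involution} {k m : ℕ}
    (h : α ∈ A (2 * k) (2 * k + 1))
    (hm : IsLeast {m : ℕ | (Θ ^ m) α ∈ A (2 * k + 1) (2 * k)} m) : swapExponent Θ α = m := by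
  have e : {m : ℕ | ∃ k, α ∈ A (2 * k) (2 * k + 1) ∧
      (Θ ^ (m : ℤ)) α ∈ A (2 * k + 1) (2 * k)} = {m : ℕ | (Θ ^ m) α ∈ A (2 * k + 1) (2 * k)} := by
    ext i
    simp only [Set.mem_ofPred_eq, zpow_natCast]
    constructor
    · rintro ⟨k', h', hi⟩
      -- The index in the definition of `swapExponent` is existential, but `α` determines it.
      obtain rfl : k' = k := (mem_A_even_odd.1 h').1.symm.trans (mem_A_even_odd.1 h).1
      exact hi
    · exact fun hi => ⟨k, h, hi⟩
  rw [swapExponent, if_pos ⟨k, h⟩, e, hm.csInf_eq]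

theorem swapExponent_of_odd_even {Θ : Equiv.Perm Involution} {α : Involution} {k m : ℕ}
    (h : α ∈ A (2 * k + 1) (2 * k))
    (hm : IsLeast {m : ℕ | (Θ⁻¹ ^ m) α ∈ A (2 * k) (2 * k + 1)} m) :
    swapExponent Θ α = -(m : ℤ) := by
  have e : {m : ℕ | ∃ k, α ∈ A (2 * k + 1) (2 * k) ∧
      (Θ ^ (-(m : ℤ))) α ∈ A (2 * k) (2 * k + 1)} =
      {m : ℕ | (Θ⁻¹ ^ m) α ∈ A (2 * k) (2 * k + 1)} := by
    ext i
    simp only [Set.mem_ofPred_eq, zpow_neg_natCast_apply]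
    constructor
    · rintro ⟨k', h', hi⟩
      obtain rfl : k' = k := (mem_A_odd_even.1 h').2.symm.trans (mem_A_odd_even.1 h).2
      exact hi
    · exact fun hi => ⟨k, h, hi⟩
  have hnot : ¬ ∃ k, α ∈ A (2 * k) (2 * k + 1) := by
    rintro ⟨k', h'⟩
    have := mem_A_even_odd.1 h'
    have := mem_A_odd_even.1 h
    omega
  rw [swapExponent, if_neg hnot, if_pos ⟨k, h⟩, e, hm.csInf_eq]

/-- The map preserves the finite set of involutions of a given size and is injective there. -/
theorem theta_periodic (α : Involution) : ∃ N, 1 ≤ N ∧ theta^[N] α = α := by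
  obtain ⟨n, α⟩ := α
  obtain ⟨N, hN, h⟩ := ((chi_injective (n := n)).comp psi_injective).mem_periodicPts α
  have hs : Function.Semiconj (Sigma.mk n : Invol n → Involution) (chi ∘ psi) theta :=
    fun _ => rfl
  refine ⟨N, hN, ?_⟩
  rw [← hs.iterate_right N α, h.eq]

section
variable {Θ : Equiv.Perm Involution}

/-- The two minimality statements of `exists_isLeast_step_up` evaluate the exponent at `α` and at
its image; that they are opposite is what makes `swapMap` involutive. -/
theorem exists_swapExponent_of_even_odd (hΘ : ∀ α, Θ α = theta α) {k : ℕ} {α : Involution}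
    (h : α ∈ A (2 * k) (2 * k + 1)) : ∃ m : ℕ, 1 ≤ m ∧ swapExponent Θ α = m ∧
      (Θ ^ m) α ∈ A (2 * k + 1) (2 * k) ∧ swapExponent Θ ((Θ ^ m) α) = -(m : ℤ) := by
  have hper : ∀ x, ∃ N, 1 ≤ N ∧ (Θ ^ N) x = x := by
    intro x
    obtain ⟨N, hN, e⟩ := theta_periodic x
    exact ⟨N, hN, by rw [← Equiv.Perm.iterate_eq_pow, (funext hΘ : ⇑Θ = theta), e]⟩
  obtain ⟨h1, h2⟩ := mem_A_even_odd.1 h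
  obtain ⟨m, hm, l1, l2⟩ := exists_isLeast_step_up (Θ := Θ) (E := enhNest) (F := openNest)
    (fun x => by rw [hΘ, openNest_theta])
    (fun x => by have := enhne_eq x; have := futne_eq x; omega) hper h1 h2
  simp only [← mem_A_even_odd, ← mem_A_odd_even] at l1 l2
  exact ⟨m, hm, swapExponent_of_even_odd h l1, l1.1, swapExponent_of_odd_even l1.1 l2⟩

/-- The orbit is read backwards: for `Θ⁻¹` the roles of `enhNest` and `openNest` are exchanged, and
a step up becomes a step down. -/
theorem exists_swapExponent_of_odd_even (hΘ : ∀ α, Θ α = theta α) {k : ℕ} {α : Involution}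
    (h : α ∈ A (2 * k + 1) (2 * k)) : ∃ m : ℕ, 1 ≤ m ∧ swapExponent Θ α = -(m : ℤ) ∧
      (Θ⁻¹ ^ m) α ∈ A (2 * k) (2 * k + 1) ∧ swapExponent Θ ((Θ⁻¹ ^ m) α) = m := by
  have hper : ∀ x, ∃ N, 1 ≤ N ∧ (Θ⁻¹ ^ N) x = x := by
    intro x
    obtain ⟨N, hN, e⟩ := theta_periodic x
    refine ⟨N, hN, ?_⟩
    rw [inv_pow, Equiv.Perm.inv_eq_iff_eq, ← Equiv.Perm.iterate_eq_pow,
      (funext hΘ : ⇑Θ = theta), e]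
  obtain ⟨h1, h2⟩ := mem_A_odd_even.1 h
  obtain ⟨m, hm, l1, l2⟩ := exists_isLeast_step_up (Θ := Θ⁻¹) (E := openNest) (F := enhNest)
    (fun x => by rw [← openNest_theta, ← hΘ, ← Equiv.Perm.mul_apply, mul_inv_cancel,
      Equiv.Perm.one_apply])
    (fun x => by have := enhne_eq x; have := futne_eq x; omega) hper h2 h1
  rw [inv_inv] at l2
  simp only [and_comm (a := openNest _ = _), ← mem_A_even_odd, ← mem_A_odd_even] at l1 l2
  exact ⟨m, hm, swapExponent_of_odd_even h l1, l1.1, swapExponent_of_even_odd l1.1 l2⟩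

theorem swapExponent_eq_zero {α : Involution} (h1 : ¬ ∃ k, α ∈ A (2 * k) (2 * k + 1))
    (h2 : ¬ ∃ k, α ∈ A (2 * k + 1) (2 * k)) : swapExponent Θ α = 0 := by
  rw [swapExponent, if_neg h1, if_neg h2]

theorem swapMap_involutive (hΘ : ∀ α, Θ α = theta α) : Function.Involutive (swapMap Θ) := by
  intro α
  by_cases h1 : ∃ k, α ∈ A (2 * k) (2 * k + 1)
  · obtain ⟨k, h⟩ := h1
    obtain ⟨m, _, e1, _, e2⟩ := exists_swapExponent_of_even_odd hΘ h
    have e : swapMap Θ α = (Θ ^ m) α := by rw [swapMap, e1, zpow_natCast]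
    rw [e, swapMap, e2, zpow_neg, zpow_natCast, ← Equiv.Perm.mul_apply, inv_mul_cancel,
      Equiv.Perm.one_apply]
  by_cases h2 : ∃ k, α ∈ A (2 * k + 1) (2 * k)
  · obtain ⟨k, h⟩ := h2
    obtain ⟨m, _, e1, _, e2⟩ := exists_swapExponent_of_odd_even hΘ h
    have e : swapMap Θ α = (Θ⁻¹ ^ m) α := by rw [swapMap, e1, zpow_neg_natCast_apply]
    rw [e, swapMap, e2, zpow_natCast, inv_pow, ← Equiv.Perm.mul_apply, mul_inv_cancel,
      Equiv.Perm.one_apply]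
  · have e : swapMap Θ α = α := by rw [swapMap, swapExponent_eq_zero h1 h2]; rfl
    rw [e, e]

theorem enhne_futne_swapMap (hΘ : ∀ α, Θ α = theta α) (α : Involution) :
    enhne (swapMap Θ α) = futne α ∧ futne (swapMap Θ α) = enhne α := by
  by_cases h1 : ∃ k, α ∈ A (2 * k) (2 * k + 1)
  · obtain ⟨k, h⟩ := h1
    obtain ⟨m, _, e1, hA, _⟩ := exists_swapExponent_of_even_odd hΘ h
    rw [swapMap, e1, zpow_natCast]
    exact ⟨hA.1.trans h.2.symm, hA.2.trans h.1.symm⟩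
  by_cases h2 : ∃ k, α ∈ A (2 * k + 1) (2 * k)
  · obtain ⟨k, h⟩ := h2
    obtain ⟨m, _, e1, hA, _⟩ := exists_swapExponent_of_odd_even hΘ h
    rw [swapMap, e1, zpow_neg_natCast_apply]
    exact ⟨hA.1.trans h.2.symm, hA.2.trans h.1.symm⟩
  · have e : swapMap Θ α = α := by rw [swapMap, swapExponent_eq_zero h1 h2]; rfl
    have := enhne_eq_futne h1 h2
    rw [e]
    exact ⟨this, this.symm⟩

end

end InvolutionNesting

open InvolutionNesting in
theorem mainTheorem10 :
    -- the inverse maps used in the construction of `θ` are well defined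
    (∀ (n : ℕ) (α : Invol n), ∃! β : Invol n, vacillating β = transposeSeq (vacillating α)) ∧
    (∀ (n : ℕ) (β : Invol n), ∃! γ : Invol n, oscColumn γ = transposeSeq (oscRow β)) ∧
    -- `θ` is a bijection
    ∃ Θ : Equiv.Perm Involution, (∀ α, Θ α = theta α) ∧
      -- the exponents `m_α` are well defined
      (∀ (k : ℕ) (α : Involution), α ∈ A (2 * k) (2 * k + 1) →
        ∃ m : ℕ, 1 ≤ m ∧ (Θ ^ (m : ℤ)) α ∈ A (2 * k + 1) (2 * k)) ∧
      (∀ (k : ℕ) (α : Involution), α ∈ A (2 * k + 1) (2 * k) →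
        ∃ m : ℕ, 1 ≤ m ∧ (Θ ^ (-(m : ℤ))) α ∈ A (2 * k) (2 * k + 1)) ∧
      -- the map `α ↦ θ^(m_α) α` is an involution with the announced properties
      Function.Involutive (swapMap Θ) ∧
      (∀ α, enhne (swapMap Θ α) = futne α) ∧
      (∀ α, futne (swapMap Θ α) = enhne α) ∧
      (∀ α, size (swapMap Θ α) = size α) ∧
      (∀ α, fixedCount (swapMap Θ α) = fixedCount α) ∧
      (∀ α, openerCloser (swapMap Θ α) = openerCloser α) := by
  refine ⟨fun n α => ?_, fun n β => ?_, Equiv.ofBijective theta theta_bijective, fun _ => rfl, ?_⟩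
  · obtain ⟨β, hβ⟩ := exists_vacillating_eq α
    exact ⟨β, hβ, fun β' h => vacillating_injective (h.trans hβ.symm)⟩
  · obtain ⟨γ, hγ⟩ := exists_oscColumn_eq β
    exact ⟨γ, hγ, fun γ' h => oscColumn_injective (h.trans hγ.symm)⟩
  have hΘ : ∀ α, Equiv.ofBijective theta theta_bijective α = theta α := fun _ => rfl
  generalize Equiv.ofBijective theta theta_bijective = Θ at hΘ
  refine ⟨fun k α h => ?_, fun k α h => ?_, swapMap_involutive hΘ,
    fun α => (enhne_futne_swapMap hΘ α).1, fun α => (enhne_futne_swapMap hΘ α).2,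
    fun α => zpow_invariant (g := size) (fun β => ?_) _ α,
    fun α => zpow_invariant (g := fixedCount) (fun β => ?_) _ α,
    fun α => zpow_invariant (g := openerCloser) (fun β => ?_) _ α⟩
  · obtain ⟨m, hm, _, hA, _⟩ := exists_swapExponent_of_even_odd hΘ h
    exact ⟨m, hm, by rwa [zpow_natCast]⟩
  · obtain ⟨m, hm, _, hA, _⟩ := exists_swapExponent_of_odd_even hΘ h
    exact ⟨m, hm, by rwa [zpow_neg_natCast_apply]⟩
  · rw [hΘ]; rfl
  · rw [hΘ, fixedCount_theta]
  · rw [hΘ, openerCloser_theta]
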